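/- Let $M$ be a smooth manifold of dimension $m\ge 1$ with a volume form $\eta$, let $\pi\colon E\to M$ be a surjective smooth submersion with $n$-dimensional fibres (for instance, a smooth fibre bundle), let $J^1\pi$ be its first-order jet bundle with projections $\pi^1\colon J^1\pi\to E$ and $\bar\pi^1=\pi\circ\pi^1\colon J^1\pi\to M$, and put $\omega=(\bar\pi^1)^*\eta$. Let $L\in C^\infty(J^1\pi)$, and let $\mathcal L=L\,\omega$ be the corresponding Lagrangian density. Let $\mathcal V$ be the vertical endomorphism of $J^1\pi$, in natural coordinates $(x^\alpha,y^A,v^A_\alpha)$ $$\mathcal V=(dy^A-v^A_\alpha dx^\alpha)\otimes\frac{\partial}{\partial v^A_\nu}\otimes\frac{\partial}{\partial x^\nu},$$ and let $\Theta_{\mathcal L}=i(\mathcal V)\mathcal L+\mathcal L$, where $i(\mathcal V)\mathcal L=\frac{\partial L}{\partial v^A_\nu}(dy^A-v^A_\alpha dx^\alpha)\wedge i(\partial/\partial x^\nu)\omega$, and $\Omega_{\mathcal L}=-d\Theta_{\mathcal L}$ be the Poincaré–Cartan $m$- and $(m+1)$-forms. Let $\nabla$ be any Ehresmann connection in the fibration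 $\bar\pi^1\colon J^1\pi\to M$, that is, a smooth horizontal subbundle $\mathrm H(\nabla)$ with $TJ^1\pi=\mathrm H(\nabla)\oplus \mathrm V(\bar\pi^1)$, where $\mathrm V(\bar\pi^1)=\ker T\bar\pi^1$. A $k$-form has bidegree $(p,q)$, $p+q=k$, if it is a section of the summand $\Lambda^p\mathrm H^*(\nabla)\otimes\Lambda^q\mathrm V^*(\bar\pi^1)$ of $\Lambda^kT^*J^1\pi$. Let $\mathcal Y^\nabla_\eta$ be the horizontal lift of the $m$-vector field $\mathcal Z$ on $M$ with $\eta(\mathcal Z)=1$, put $(\gamma_{\mathcal L})^\nabla_\eta=i(\mathcal Y^\nabla_\eta)\Omega_{\mathcal L}$ (for $\mathcal Y^\nabla_\eta=w_1\wedge\dots\wedge w_m$ this is $v\mapsto\Omega_{\mathcal L}(w_1,\dots,w_m,v)$), and let $\Omega^\nabla_{\mathcal L}$ be the sum of all components of $\Omega_{\mathcal L}$ other than the one of bidegree $(m,1)$. Then $(\gamma_{\mathcal L})^\nabla_\eta$ is a smooth $1$-form on $J^1\pi$, $\Omega^\nabla_{\mathcal L}$ is a smooth $(m+1)$-form on $J^1\pi$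 of bidegree $(m-1,2)$ with respect to $\nabla$, and $$\Omega_{\mathcal L}=\omega\wedge(\gamma_{\mathcal L})^\nabla_\eta+\Omega^\nabla_{\mathcal L}.$$ Moreover, $\Omega_{\mathcal L}$ vanishes whenever three of its arguments are tangent to the fibres of $\bar\pi^1$, that is, $i(Z_1)i(Z_2)i(Z_3)\Omega_{\mathcal L}=0$ for all $\bar\pi^1$-vertical vector fields $Z_1,Z_2,Z_3$. -/

import Mathlib

open scoped Manifold ContDiff

noncomputable section

namespace FieldTheory

/-- The model space `ℝᵏ`. -/
abbrev R (k : ℕ) : Type := EuclideanSpace ℝ (Fin k)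

section Jets

variable {m n : ℕ} {M E : Type*} [TopologicalSpace M] [ChartedSpace (R m) M]
  [TopologicalSpace E] [ChartedSpace (R (m + n)) E]

/-- A fibred manifold `π : E → M` with `dim M = m` and fibres of dimension `n`, that is, a
surjective smooth submersion. Every smooth fibre bundle is of this kind. -/
structure FibredManifold (m n : ℕ) (M E : Type*) [TopologicalSpace M] [ChartedSpace (R m) M]
    [TopologicalSpace E] [ChartedSpace (R (m + n)) E] where
  /-- the projection -/
  proj : E → M
  surjective : Function.Surjective proj
  isSubmersion : Manifold.IsSubmersionOfComplement (R n) (𝓡 (m + n)) (𝓡 m) ∞ proj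

/-- The first-order jet bundle `J¹π`. The 1-jet at `x` of a local section `φ` is recorded by the
point `φ x` and the tangent map `T_x φ : T_x M → T_{φ x} E`; the linear maps that occur in this way
are exactly the right inverses of `T_{φ x} π`. -/
structure Jet (π : FibredManifold m n M E) where
  /-- the target `φ x` of the jet -/
  point : E
  /-- the tangent map `T_x φ` -/
  lift : TangentSpace (𝓡 m) (π.proj point) →L[ℝ] TangentSpace (𝓡 (m + n)) point
  mfderiv_comp_lift : (mfderiv (𝓡 (m + n)) (𝓡 m) π.proj point).comp lift =
    ContinuousLinearMap.id ℝ (TangentSpace (𝓡 m) (π.proj point))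

/-- Fibred coordinates `(x^α, y^A)` on an open subset of `E`, over coordinates `x^α` on `M`. -/
structure AdaptedChart (π : FibredManifold m n M E) where
  /-- the coordinates `(x^α, y^A)` -/
  tot : OpenPartialHomeomorph E (R m × R n)
  /-- the coordinates `x^α` -/
  base : OpenPartialHomeomorph M (R m)
  smooth_tot : ContMDiffOn (𝓡 (m + n)) 𝓘(ℝ, R m × R n) ∞ tot tot.source
  smooth_tot_symm : ContMDiffOn 𝓘(ℝ, R m × R n) (𝓡 (m + n)) ∞ tot.symm tot.target
  smooth_base : ContMDiffOn (𝓡 m) (𝓡 m) ∞ base base.source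
  smooth_base_symm : ContMDiffOn (𝓡 m) (𝓡 m) ∞ base.symm base.target
  proj_mem : ∀ e ∈ tot.source, π.proj e ∈ base.source
  fst_tot : ∀ e ∈ tot.source, (tot e).1 = base (π.proj e)

variable {π : FibredManifold m n M E}

theorem FibredManifold.smooth (π : FibredManifold m n M E) :
    ContMDiff (𝓡 (m + n)) (𝓡 m) ∞ π.proj := π.isSubmersion.contMDiff

theorem exists_adaptedChart (π : FibredManifold m n M E) (e : E) :
    ∃ c : AdaptedChart π, e ∈ c.tot.source := by
  have h := π.isSubmersion e
  refine ⟨⟨h.domChart.transHomeomorph h.equiv.toHomeomorph, h.codChart, ?_, ?_, ?_, ?_, ?_, ?_⟩, ?_⟩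
  · exact h.equiv.contDiff.contMDiff.comp_contMDiffOn
      (contMDiffOn_of_mem_maximalAtlas h.domChart_mem_maximalAtlas)
  · exact (contMDiffOn_symm_of_mem_maximalAtlas h.domChart_mem_maximalAtlas).comp
      h.equiv.symm.contDiff.contMDiff.contMDiffOn (fun z hz => hz)
  · exact contMDiffOn_of_mem_maximalAtlas h.codChart_mem_maximalAtlas
  · exact contMDiffOn_symm_of_mem_maximalAtlas h.codChart_mem_maximalAtlas
  · intro e he
    exact h.source_subset_preimage_source he
  · intro e he
    have he' : e ∈ h.domChart.source := he
    have ht : h.domChart e ∈ (h.domChart.extend (𝓡 (m + n))).target := by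
      simpa [OpenPartialHomeomorph.extend_target] using h.domChart.map_source he'
    have := h.writtenInCharts ht
    simpa [h.domChart.left_inv he'] using this.symm
  · exact h.mem_domChart_source

namespace AdaptedChart

variable (c : AdaptedChart π)

theorem mdiff_tot {e : E} (he : e ∈ c.tot.source) :
    MDifferentiableAt (𝓡 (m + n)) 𝓘(ℝ, R m × R n) c.tot e :=
  (c.smooth_tot.contMDiffAt (c.tot.open_source.mem_nhds he)).mdifferentiableAt (by simp)

theorem mdiff_tot_symm {z : R m × R n} (hz : z ∈ c.tot.target) :
    MDifferentiableAt 𝓘(ℝ, R m × R n) (𝓡 (m + n)) c.tot.symm z :=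
  (c.smooth_tot_symm.contMDiffAt (c.tot.open_target.mem_nhds hz)).mdifferentiableAt (by simp)

theorem mdiff_base {x : M} (hx : x ∈ c.base.source) :
    MDifferentiableAt (𝓡 m) (𝓡 m) c.base x :=
  (c.smooth_base.contMDiffAt (c.base.open_source.mem_nhds hx)).mdifferentiableAt (by simp)

theorem mdiff_base_symm {z : R m} (hz : z ∈ c.base.target) :
    MDifferentiableAt (𝓡 m) (𝓡 m) c.base.symm z :=
  (c.smooth_base_symm.contMDiffAt (c.base.open_target.mem_nhds hz)).mdifferentiableAt (by simp)

theorem mdiff_proj (e : E) : MDifferentiableAt (𝓡 (m + n)) (𝓡 m) π.proj e :=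
  (π.smooth e).mdifferentiableAt (by simp)

/-- The differential of the fibred coordinates at `e`. -/
def dTot (e : E) : R (m + n) →L[ℝ] R m × R n := mfderiv (𝓡 (m + n)) 𝓘(ℝ, R m × R n) c.tot e

/-- The differential of the inverse of the fibred coordinates at `z`. -/
def dTotSymm (z : R m × R n) : R m × R n →L[ℝ] R (m + n) :=
  mfderiv 𝓘(ℝ, R m × R n) (𝓡 (m + n)) c.tot.symm z

/-- The differential of the base coordinates at `x`. -/
def dBase (x : M) : R m →L[ℝ] R m := mfderiv (𝓡 m) (𝓡 m) c.base x

/-- The differential of the inverse of the base coordinates at `z`. -/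
def dBaseSymm (z : R m) : R m →L[ℝ] R m := mfderiv (𝓡 m) (𝓡 m) c.base.symm z

/-- The differential of the projection `π` at `e`. -/
def dProj (π : FibredManifold m n M E) (e : E) : R (m + n) →L[ℝ] R m :=
  mfderiv (𝓡 (m + n)) (𝓡 m) π.proj e

theorem base_mem_target {e : E} (he : e ∈ c.tot.source) :
    c.base (π.proj e) ∈ c.base.target := c.base.map_source (c.proj_mem e he)

theorem dTotSymm_comp_dTot {e : E} (he : e ∈ c.tot.source) :
    (c.dTotSymm (c.tot e)).comp (c.dTot e) = .id ℝ _ := by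
  have h := mfderiv_comp e (c.mdiff_tot_symm (c.tot.map_source he)) (c.mdiff_tot he)
  have h2 : (c.tot.symm ∘ c.tot) =ᶠ[nhds e] id :=
    Filter.eventuallyEq_of_mem (c.tot.open_source.mem_nhds he) fun x hx => c.tot.left_inv hx
  exact h.symm.trans (h2.mfderiv_eq.trans mfderiv_id)

theorem dTot_comp_dTotSymm {z : R m × R n} (hz : z ∈ c.tot.target) :
    (c.dTot (c.tot.symm z)).comp (c.dTotSymm z) = .id ℝ _ := by
  have h := mfderiv_comp z (c.mdiff_tot (c.tot.map_target hz)) (c.mdiff_tot_symm hz)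
  have h2 : (c.tot ∘ c.tot.symm) =ᶠ[nhds z] id :=
    Filter.eventuallyEq_of_mem (c.tot.open_target.mem_nhds hz) fun x hx => c.tot.right_inv hx
  exact h.symm.trans (h2.mfderiv_eq.trans mfderiv_id)

theorem dBaseSymm_comp_dBase {x : M} (hx : x ∈ c.base.source) :
    (c.dBaseSymm (c.base x)).comp (c.dBase x) = .id ℝ _ := by
  have h := mfderiv_comp x (c.mdiff_base_symm (c.base.map_source hx)) (c.mdiff_base hx)
  have h2 : (c.base.symm ∘ c.base) =ᶠ[nhds x] id :=
    Filter.eventuallyEq_of_mem (c.base.open_source.mem_nhds hx) fun x hx => c.base.left_inv hx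
  exact h.symm.trans (h2.mfderiv_eq.trans mfderiv_id)

theorem dBase_comp_dBaseSymm {z : R m} (hz : z ∈ c.base.target) :
    (c.dBase (c.base.symm z)).comp (c.dBaseSymm z) = .id ℝ _ := by
  have h := mfderiv_comp z (c.mdiff_base (c.base.map_target hz)) (c.mdiff_base_symm hz)
  have h2 : (c.base ∘ c.base.symm) =ᶠ[nhds z] id :=
    Filter.eventuallyEq_of_mem (c.base.open_target.mem_nhds hz) fun x hx => c.base.right_inv hx
  exact h.symm.trans (h2.mfderiv_eq.trans mfderiv_id)

theorem fst_comp_dTot {e : E} (he : e ∈ c.tot.source) :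
    (ContinuousLinearMap.fst ℝ (R m) (R n)).comp (c.dTot e) =
      (c.dBase (π.proj e)).comp (dProj π e) := by
  have hf : HasMFDerivAt 𝓘(ℝ, R m × R n) (𝓡 m) (Prod.fst : R m × R n → R m) (c.tot e)
      (ContinuousLinearMap.fst ℝ (R m) (R n)) := (hasFDerivAt_fst (𝕜 := ℝ)).hasMFDerivAt
  have h1 := hf.comp e (c.mdiff_tot he).hasMFDerivAt
  have h2 := (c.mdiff_base (c.proj_mem e he)).hasMFDerivAt.comp e (mdiff_proj e).hasMFDerivAt
  have h3 : (Prod.fst ∘ c.tot : E → R m) =ᶠ[nhds e] c.base ∘ π.proj :=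
    Filter.eventuallyEq_of_mem (c.tot.open_source.mem_nhds he) fun x hx => c.fst_tot x hx
  exact hasMFDerivAt_unique (h1.congr_of_eventuallyEq h3.symm) h2

end AdaptedChart

/-- The tangent map of a 1-jet, read in the model spaces. -/
def Jet.tangent (j : Jet π) : R m →L[ℝ] R (m + n) := j.lift

theorem Jet.dProj_comp_tangent (j : Jet π) :
    (AdaptedChart.dProj π j.point).comp j.tangent = .id ℝ _ := j.mfderiv_comp_lift

theorem Jet.ext' {j j' : Jet π} (h : j.point = j'.point) (h' : j.tangent = j'.tangent) :
    j = j' := by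
  obtain ⟨p, l, hl⟩ := j
  obtain ⟨p', l', hl'⟩ := j'
  obtain rfl : p = p' := h
  obtain rfl : l = l' := h'
  rfl

/-- The model space of `J¹π`: the natural coordinates are `((x^α, y^A), v^A_α)`. -/
abbrev JetModel (m n : ℕ) : Type := (R m × R n) × (R m →L[ℝ] R n)

namespace AdaptedChart

variable (c : AdaptedChart π)

/-- The coordinates `v^A_α` of a 1-jet: the matrix of partial derivatives of the section. -/
def velocity (j : Jet π) : R m →L[ℝ] R n :=
  (ContinuousLinearMap.snd ℝ (R m) (R n)).comp
    ((c.dTot j.point).comp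
      (j.tangent.comp (c.dBaseSymm (c.base (π.proj j.point)))))

theorem dTot_comp_tangent (j : Jet π) (hj : j.point ∈ c.tot.source) :
    (c.dTot j.point).comp j.tangent =
      ((ContinuousLinearMap.id ℝ (R m)).prod (c.velocity j)).comp (c.dBase (π.proj j.point)) := by
  have h1 := c.fst_comp_dTot hj
  have h2 := j.dProj_comp_tangent
  have h3 := c.dBaseSymm_comp_dBase (c.proj_mem _ hj)
  refine ContinuousLinearMap.ext fun (u : R m) => ?_
  have e1 := DFunLike.congr_fun h1 (j.tangent u)
  have e2 := DFunLike.congr_fun h2 u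
  have e3 := DFunLike.congr_fun h3 u
  simp only [ContinuousLinearMap.comp_apply, ContinuousLinearMap.id_apply,
    ContinuousLinearMap.coe_fst'] at e1 e2 e3
  refine Prod.ext ?_ ?_
  · simp [e1, e2]
  · simp [velocity, e3]

/-- The 1-jet with given natural coordinates. -/
def mkJet (z : R m × R n) (v : R m →L[ℝ] R n) (hz : z ∈ c.tot.target) : Jet π where
  point := c.tot.symm z
  lift := ((c.dTotSymm z).comp (((ContinuousLinearMap.id ℝ (R m)).prod v).comp
    (c.dBase (π.proj (c.tot.symm z)))) : R m →L[ℝ] R (m + n))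
  mfderiv_comp_lift := by
    have hs := c.tot.map_target hz
    have h1 := c.fst_comp_dTot hs
    have h2 := c.dTot_comp_dTotSymm hz
    have h3 := c.dBaseSymm_comp_dBase (c.proj_mem _ hs)
    change (dProj π (c.tot.symm z)).comp _ = ContinuousLinearMap.id ℝ (R m)
    refine ContinuousLinearMap.ext fun (u : R m) => ?_
    have e2 := DFunLike.congr_fun h2 (c.dBase (π.proj (c.tot.symm z)) u,
      v (c.dBase (π.proj (c.tot.symm z)) u))
    have e1 := DFunLike.congr_fun h1 (c.dTotSymm z (c.dBase (π.proj (c.tot.symm z)) u,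
      v (c.dBase (π.proj (c.tot.symm z)) u)))
    have e3 := fun w => DFunLike.congr_fun h3 w
    simp only [ContinuousLinearMap.comp_apply, ContinuousLinearMap.id_apply,
      ContinuousLinearMap.coe_fst'] at e1 e2 e3
    rw [e2] at e1
    have := congrArg (c.dBaseSymm (c.base (π.proj (c.tot.symm z)))) e1
    rw [e3, e3] at this
    simpa using this.symm

theorem mkJet_tangent (z : R m × R n) (v : R m →L[ℝ] R n) (hz : z ∈ c.tot.target) :
    (c.mkJet z v hz).tangent = (c.dTotSymm z).comp (((ContinuousLinearMap.id ℝ (R m)).prod v).comp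
      (c.dBase (π.proj (c.tot.symm z)))) := rfl

open Classical in
/-- The natural chart `(x^α, y^A, v^A_α)` of `J¹π` induced by fibred coordinates `c`. The jet `j₀`
only serves as the value of the inverse outside of the target. -/
def jetChart (j₀ : Jet π) : PartialEquiv (Jet π) (JetModel m n) where
  toFun j := (c.tot j.point, c.velocity j)
  invFun p := if hp : p.1 ∈ c.tot.target then c.mkJet p.1 p.2 hp else j₀
  source := {j | j.point ∈ c.tot.source}
  target := {p | p.1 ∈ c.tot.target}
  map_source' j hj := c.tot.map_source hj
  map_target' p hp := by
    have hp' : p.1 ∈ c.tot.target := hp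
    simp [hp', mkJet, c.tot.map_target hp']
  left_inv' j hj := by
    have hj' : c.tot j.point ∈ c.tot.target := c.tot.map_source hj
    have hs : c.tot.symm (c.tot j.point) = j.point := c.tot.left_inv hj
    simp only [hj', dite_true]
    refine Jet.ext' hs ?_
    have h1 := c.dTot_comp_tangent j hj
    have h2 := c.dTotSymm_comp_dTot hj
    have hp : ∀ e : E, e = j.point → (c.dTotSymm (c.tot j.point)).comp
        (((ContinuousLinearMap.id ℝ (R m)).prod (c.velocity j)).comp (c.dBase (π.proj e))) =
        j.tangent := by
      rintro e rfl
      rw [← h1, ← ContinuousLinearMap.comp_assoc, h2, ContinuousLinearMap.id_comp]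
    exact hp _ hs
  right_inv' p hp := by
    obtain ⟨z, v⟩ := p
    have hp' : z ∈ c.tot.target := hp
    have hs := c.tot.map_target hp'
    simp only [hp', dite_true]
    refine Prod.ext (c.tot.right_inv hp') ?_
    have h2 := c.dTot_comp_dTotSymm hp'
    have hb : c.base (π.proj (c.tot.symm z)) ∈ c.base.target := c.base_mem_target hs
    have h3 := c.dBase_comp_dBaseSymm hb
    rw [c.base.left_inv (c.proj_mem _ hs)] at h3
    refine ContinuousLinearMap.ext fun (u : R m) => ?_
    have e3 := DFunLike.congr_fun h3 u
    have e2 := fun w => DFunLike.congr_fun h2 w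
    simp only [ContinuousLinearMap.comp_apply, ContinuousLinearMap.id_apply] at e2 e3
    simp only [velocity, mkJet_tangent, ContinuousLinearMap.comp_apply]
    simp [mkJet, e2, e3]

theorem jetChart_transition_source (c c' : AdaptedChart π) (j₀ j₀' : Jet π) :
    ((c.jetChart j₀).symm.trans (c'.jetChart j₀')).source =
      (c.tot.symm.trans c'.tot).source ×ˢ Set.univ := by
  ext ⟨z, v⟩
  by_cases hz : z ∈ c.tot.target <;>
    simp [PartialEquiv.trans_source, jetChart, hz, mkJet]

theorem isOpen_jetChart_transition_source (c c' : AdaptedChart π) (j₀ j₀' : Jet π) :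
    IsOpen ((c.jetChart j₀).symm.trans (c'.jetChart j₀')).source := by
  rw [jetChart_transition_source]
  exact (c.tot.symm.trans c'.tot).open_source.prod isOpen_univ

theorem contDiffOn_tot (c c' : AdaptedChart π) :
    ContDiffOn ℝ ∞ (c'.tot ∘ c.tot.symm) (c.tot.symm.trans c'.tot).source := by
  rw [← contMDiffOn_iff_contDiffOn]
  exact c'.smooth_tot.comp (c.smooth_tot_symm.mono fun z hz => hz.1) fun z hz => hz.2

theorem contDiffOn_base (c c' : AdaptedChart π) :
    ContDiffOn ℝ ∞ (c'.base ∘ c.base.symm) (c.base.symm.trans c'.base).source := by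
  rw [← contMDiffOn_iff_contDiffOn]
  exact c'.smooth_base.comp (c.smooth_base_symm.mono fun z hz => hz.1) fun z hz => hz.2

/-- The velocity coordinates transform affinely under a change of fibred coordinates. -/
theorem velocity_mkJet (c c' : AdaptedChart π) (z : R m × R n) (v : R m →L[ℝ] R n)
    (hz : z ∈ c.tot.target) (hz' : c.tot.symm z ∈ c'.tot.source) :
    c'.velocity (c.mkJet z v hz) = (ContinuousLinearMap.snd ℝ (R m) (R n)).comp
      ((fderiv ℝ (c'.tot ∘ c.tot.symm) z).comp (((ContinuousLinearMap.id ℝ (R m)).prod v).comp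
        (fderiv ℝ (c.base ∘ c'.base.symm) (((c'.tot ∘ c.tot.symm) z).1)))) := by
  have hs := c.tot.map_target hz
  have h1 : fderiv ℝ (c'.tot ∘ c.tot.symm) z = (c'.dTot (c.tot.symm z)).comp (c.dTotSymm z) := by
    rw [← mfderiv_eq_fderiv]
    exact mfderiv_comp z (c'.mdiff_tot hz') (c.mdiff_tot_symm hz)
  have hx : π.proj (c.tot.symm z) ∈ c'.base.source := c'.proj_mem _ hz'
  have hx' : c'.base.symm (c'.base (π.proj (c.tot.symm z))) = π.proj (c.tot.symm z) :=
    c'.base.left_inv hx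
  have h2 : fderiv ℝ (c.base ∘ c'.base.symm) (c'.base (π.proj (c.tot.symm z))) =
      (c.dBase (π.proj (c.tot.symm z))).comp
        (c'.dBaseSymm (c'.base (π.proj (c.tot.symm z)))) := by
    rw [← mfderiv_eq_fderiv]
    have := mfderiv_comp (I := 𝓡 m) (I' := 𝓡 m) (I'' := 𝓡 m)
      (c'.base (π.proj (c.tot.symm z))) (g := c.base) (f := c'.base.symm)
      (by rw [hx']; exact c.mdiff_base (c.proj_mem _ hs))
      (c'.mdiff_base_symm (c'.base.map_source hx))
    rw [hx'] at this
    exact this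
  have h3 : ((c'.tot ∘ c.tot.symm) z).1 = c'.base (π.proj (c.tot.symm z)) := c'.fst_tot _ hz'
  rw [h3, h1, h2]
  rfl

theorem jetChart_transition (c c' : AdaptedChart π) (j₀ j₀' : Jet π) :
    ContDiffOn ℝ ∞ ((c.jetChart j₀).symm.trans (c'.jetChart j₀'))
      ((c.jetChart j₀).symm.trans (c'.jetChart j₀')).source := by
  rw [jetChart_transition_source]
  set S := (c.tot.symm.trans c'.tot).source with hS
  have hT := contDiffOn_tot c c'
  have hSo : IsOpen S := (c.tot.symm.trans c'.tot).open_source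
  have hB := contDiffOn_base c' c
  have hBo : IsOpen (c'.base.symm.trans c.base).source := (c'.base.symm.trans c.base).open_source
  have hmaps : ∀ z ∈ S, ((c'.tot ∘ c.tot.symm) z).1 ∈ (c'.base.symm.trans c.base).source := by
    intro z hz
    have hz1 : z ∈ c.tot.target := hz.1
    have hz2 : c.tot.symm z ∈ c'.tot.source := hz.2
    have h3 : ((c'.tot ∘ c.tot.symm) z).1 = c'.base (π.proj (c.tot.symm z)) := c'.fst_tot _ hz2
    rw [h3]
    refine ⟨c'.base_mem_target hz2, ?_⟩
    change c'.base.symm _ ∈ c.base.source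
    rw [c'.base.left_inv (c'.proj_mem _ hz2)]
    exact c.proj_mem _ (c.tot.map_target hz1)
  have hfst : ContDiffOn ℝ ∞ (fun p : JetModel m n => p.1) (S ×ˢ Set.univ) :=
    contDiff_fst.contDiffOn
  have hsnd : ContDiffOn ℝ ∞ (fun p : JetModel m n => p.2) (S ×ˢ Set.univ) :=
    contDiff_snd.contDiffOn
  have hT1 : ContDiffOn ℝ ∞ (fun p : JetModel m n => (c'.tot ∘ c.tot.symm) p.1)
      (S ×ˢ Set.univ) := hT.comp hfst fun p hp => hp.1
  have hDT : ContDiffOn ℝ ∞ (fun p : JetModel m n => fderiv ℝ (c'.tot ∘ c.tot.symm) p.1)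
      (S ×ˢ Set.univ) :=
    (hT.fderiv_of_isOpen hSo (by simp)).comp hfst fun p hp => hp.1
  have hDB : ContDiffOn ℝ ∞ (fun p : JetModel m n =>
      fderiv ℝ (c.base ∘ c'.base.symm) (((c'.tot ∘ c.tot.symm) p.1).1)) (S ×ˢ Set.univ) :=
    (hB.fderiv_of_isOpen hBo (by simp)).comp (contDiff_fst.comp_contDiffOn hT1)
      fun p hp => hmaps p.1 hp.1
  have hid : ContDiffOn ℝ ∞ (fun p : JetModel m n => (ContinuousLinearMap.id ℝ (R m)).prod p.2)
      (S ×ˢ Set.univ) := by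
    have : (fun p : JetModel m n => (ContinuousLinearMap.id ℝ (R m)).prod p.2) =
        fun p => (ContinuousLinearMap.inl ℝ (R m) (R n)).comp (ContinuousLinearMap.id ℝ (R m)) +
          (ContinuousLinearMap.inr ℝ (R m) (R n)).comp p.2 := by
      funext p
      ext u <;> simp
    rw [this]
    exact contDiffOn_const.add (contDiffOn_const.clm_comp hsnd)
  refine (hT1.prodMk (contDiffOn_const.clm_comp
    (hDT.clm_comp (hid.clm_comp hDB)))).congr (f := fun p : JetModel m n =>
      ((c'.tot ∘ c.tot.symm) p.1, (ContinuousLinearMap.snd ℝ (R m) (R n)).comp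
      ((fderiv ℝ (c'.tot ∘ c.tot.symm) p.1).comp
        (((ContinuousLinearMap.id ℝ (R m)).prod p.2).comp
          (fderiv ℝ (c.base ∘ c'.base.symm) (((c'.tot ∘ c.tot.symm) p.1).1)))))) ?_
  rintro ⟨z, v⟩ hp
  have hz : z ∈ c.tot.target := hp.1.1
  have hz' : c.tot.symm z ∈ c'.tot.source := hp.1.2
  refine Prod.ext ?_ ?_
  · simp [jetChart, hz, mkJet]
  · simpa [jetChart, hz] using velocity_mkJet c c' z v hz hz'

end AdaptedChart

/-- The natural charts of `J¹π`. -/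
def jetCore (π : FibredManifold m n M E) : ChartedSpaceCore (JetModel m n) (Jet π) where
  atlas := {f | ∃ (c : AdaptedChart π) (j₀ : Jet π), f = c.jetChart j₀}
  chartAt j := (exists_adaptedChart π j.point).choose.jetChart j
  mem_chart_source j := (exists_adaptedChart π j.point).choose_spec
  chart_mem_atlas j := ⟨_, _, rfl⟩
  open_source := by
    rintro _ _ ⟨c, j₀, rfl⟩ ⟨c', j₀', rfl⟩
    exact AdaptedChart.isOpen_jetChart_transition_source c c' j₀ j₀'
  continuousOn_toFun := by
    rintro _ _ ⟨c, j₀, rfl⟩ ⟨c', j₀', rfl⟩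
    exact (AdaptedChart.jetChart_transition c c' j₀ j₀').continuousOn

instance : TopologicalSpace (Jet π) := (jetCore π).toTopologicalSpace

instance : ChartedSpace (JetModel m n) (Jet π) := (jetCore π).toChartedSpace

instance : IsManifold 𝓘(ℝ, JetModel m n) ∞ (Jet π) := by
  refine isManifold_of_contDiffOn _ _ _ ?_
  rintro e e' he he'
  have key : ∀ e ∈ atlas (JetModel m n) (Jet π), ∃ (c : AdaptedChart π) (j₀ : Jet π),
      e.toPartialEquiv = c.jetChart j₀ := by
    intro e he
    obtain ⟨f, hf⟩ := Set.mem_iUnion.1 he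
    obtain ⟨⟨c, j₀, rfl⟩, rfl⟩ := Set.mem_iUnion.1 hf
    exact ⟨c, j₀, rfl⟩
  obtain ⟨c, j₀, h⟩ := key e he
  obtain ⟨c', j₀', h'⟩ := key e' he'
  have := AdaptedChart.jetChart_transition c c' j₀ j₀'
  rw [← h, ← h'] at this
  simpa using this

end Jets

section Forms

variable {V W : Type*} [NormedAddCommGroup V] [NormedSpace ℝ V]
  [NormedAddCommGroup W] [NormedSpace ℝ W]
  {N Q : Type*} [TopologicalSpace N] [ChartedSpace V N] [TopologicalSpace Q] [ChartedSpace W Q]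
  {k : ℕ}

instance [FiniteDimensional ℝ V] (y : N) : FiniteDimensional ℝ (TangentSpace 𝓘(ℝ, V) y) :=
  inferInstanceAs (FiniteDimensional ℝ V)

instance (y : N) : T2Space (TangentSpace 𝓘(ℝ, V) y) := inferInstanceAs (T2Space V)

/-- Fields of alternating `k`-forms on a manifold `N` modelled on `V`. The differential `k`-forms
are those that satisfy `DForm.IsSmooth`. -/
abbrev DForm (V : Type*) [NormedAddCommGroup V] [NormedSpace ℝ V] (N : Type*)
    [TopologicalSpace N] [ChartedSpace V N] (k : ℕ) : Type _ :=
  (y : N) → TangentSpace 𝓘(ℝ, V) y [⋀^Fin k]→L[ℝ] ℝ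

namespace DForm

/-- The expression of a form in the preferred chart at `y₀`: its pullback by the inverse of the
chart. -/
def inChart (α : DForm V N k) (y₀ : N) (z : V) : V [⋀^Fin k]→L[ℝ] ℝ :=
  (α ((chartAt V y₀).symm z)).compContinuousLinearMap
    (mfderiv 𝓘(ℝ, V) 𝓘(ℝ, V) (chartAt V y₀).symm z)

/-- A form is smooth if all its expressions in charts are smooth. -/
def IsSmooth (α : DForm V N k) : Prop :=
  ∀ y₀ : N, ContDiffOn ℝ ∞ (α.inChart y₀) (chartAt V y₀).target

/-- The exterior derivative, computed at each point `y` in the preferred chart at `y`. -/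
def extDeriv (α : DForm V N k) : DForm V N (k + 1) := fun y =>
  (_root_.extDeriv (α.inChart y) (chartAt V y y)).compContinuousLinearMap
    (mfderiv 𝓘(ℝ, V) 𝓘(ℝ, V) (chartAt V y) y)

/-- The pullback of a form. -/
def pullback (f : N → Q) (α : DForm W Q k) : DForm V N k := fun y =>
  (α (f y)).compContinuousLinearMap (mfderiv 𝓘(ℝ, V) 𝓘(ℝ, W) f y)

end DForm

/-- The wedge product of alternating forms,
`(α ∧ β)(v₁, …, v_{k+l}) = ∑ sgn(σ) α(v_{σ 1}, …, v_{σ k}) β(v_{σ (k+1)}, …, v_{σ (k+l)})`,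
the sum being over the `(k, l)`-shuffles `σ`. -/
def wedge {T : Type*} [AddCommGroup T] [Module ℝ T] {k l : ℕ}
    (α : T [⋀^Fin k]→ₗ[ℝ] ℝ) (β : T [⋀^Fin l]→ₗ[ℝ] ℝ) : T [⋀^Fin (k + l)]→ₗ[ℝ] ℝ :=
  ((LinearMap.mul' ℝ ℝ).compAlternatingMap (α.domCoprod β)).domDomCongr finSumFinEquiv

section Mixed

variable {T T' : Type*} [AddCommGroup T] [Module ℝ T] [TopologicalSpace T]
  [AddCommGroup T'] [Module ℝ T'] [TopologicalSpace T']

/-- For an alternating `k`-form `f` on `T'` and linear maps `A B : T → T'`, the `k`-form on `T`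
`(v₁, …, v_k) ↦ ∑_S f(w₁, …, w_k)`, with `wᵢ = A vᵢ` for `i ∈ S` and `wᵢ = B vᵢ` for `i ∉ S`,
the sum being over all subsets `S` of the set of indices with exactly `p` elements. -/
def mixedPart (p : ℕ) (f : T' [⋀^Fin k]→L[ℝ] ℝ) (A B : T →L[ℝ] T') : T [⋀^Fin k]→L[ℝ] ℝ where
  toContinuousMultilinearMap := ∑ S ∈ Finset.powersetCard p (Finset.univ : Finset (Fin k)),
    f.toContinuousMultilinearMap.compContinuousLinearMap fun i => if i ∈ S then A else B
  map_eq_zero_of_eq' := by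
    intro v i j hv hij
    have hσ : ∀ a, v (Equiv.swap i j a) = v a := by
      intro a
      rw [Equiv.swap_apply_def]
      split_ifs with h h'
      · rw [h, hv]
      · rw [h', hv]
      · rfl
    let g : Finset (Fin k) → Fin k → T' := fun S a => if a ∈ S then A (v a) else B (v a)
    have hg : ∀ S, g (S.map (Equiv.swap i j).toEmbedding) = g S ∘ Equiv.swap i j := by
      intro S
      funext a
      simp only [g, Function.comp_apply, hσ, Finset.mem_map_equiv, Equiv.symm_swap]
    have hsum : ∑ S ∈ Finset.powersetCard p (Finset.univ : Finset (Fin k)), f (g S) = 0 := by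
      refine Finset.sum_involution (fun S _ => S.map (Equiv.swap i j).toEmbedding) ?_ ?_ ?_ ?_
      · intro S _
        rw [hg]
        have := f.toAlternatingMap.map_swap (g S) hij
        change f (g S ∘ Equiv.swap i j) = - f (g S) at this
        rw [this, add_neg_cancel]
      · intro S _ hne heq
        apply hne
        refine f.map_eq_zero_of_eq (g S) (i := i) (j := j) ?_ hij
        have := congrFun (hg S) i
        rw [heq] at this
        simpa using this
      · intro S hS
        simpa [Finset.mem_powersetCard] using hS
      · intro S _
        ext a
        simp [Finset.mem_map_equiv]
    have happ : ∀ S : Finset (Fin k), (f.toContinuousMultilinearMap.compContinuousLinearMap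
        fun i => if i ∈ S then A else B) v = f (g S) := by
      intro S
      rw [ContinuousMultilinearMap.compContinuousLinearMap_apply]
      change f _ = _
      congr 1
      funext a
      by_cases h : a ∈ S <;> simp [g, h]
    change (∑ S ∈ Finset.powersetCard p (Finset.univ : Finset (Fin k)),
      f.toContinuousMultilinearMap.compContinuousLinearMap fun i => if i ∈ S then A else B) v = 0
    rw [_root_.sum_apply, ← hsum]
    exact Finset.sum_congr rfl fun S _ => happ S

theorem mixedPart_apply (p : ℕ) (f : T' [⋀^Fin k]→L[ℝ] ℝ) (A B : T →L[ℝ] T') (v : Fin k → T) :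
    mixedPart p f A B v = ∑ S ∈ Finset.powersetCard p (Finset.univ : Finset (Fin k)),
      f fun i => if i ∈ S then A (v i) else B (v i) := by
  change (∑ S ∈ Finset.powersetCard p (Finset.univ : Finset (Fin k)),
      f.toContinuousMultilinearMap.compContinuousLinearMap fun i => if i ∈ S then A else B) v = _
  rw [_root_.sum_apply]
  refine Finset.sum_congr rfl fun S _ => ?_
  rw [ContinuousMultilinearMap.compContinuousLinearMap_apply]
  change f _ = _
  congr 1
  funext a
  by_cases h : a ∈ S <;> simp [h]

end Mixed

/-- The contraction `i(X)α` of an `(m+1)`-form with an `m`-vector: the 1-form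
`v ↦ α(X ∧ v)`, which for `X = w₁ ∧ ⋯ ∧ w_m` is `v ↦ α(w₁, …, w_m, v) = (-1)^m α(v, w₁, …, w_m)`. -/
def contract {m : ℕ} {T : Type*} [AddCommGroup T] [Module ℝ T] [TopologicalSpace T]
    [IsTopologicalAddGroup T] [ContinuousSMul ℝ T] [T2Space T] [FiniteDimensional ℝ T]
    (X : ⋀[ℝ]^m T) (α : T [⋀^Fin (m + 1)]→L[ℝ] ℝ) : T [⋀^Fin 1]→L[ℝ] ℝ :=
  ContinuousAlternatingMap.ofSubsingleton ℝ T ℝ 0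
    (LinearMap.toContinuousLinearMap (((-1 : ℝ) ^ m) •
      (LinearMap.applyₗ X ∘ₗ exteriorPower.alternatingMapLinearEquiv.toLinearMap ∘ₗ
        α.toAlternatingMap.curryLeft)))

/-- A volume form: a smooth nowhere vanishing form of top degree. -/
structure IsVolumeForm {m : ℕ} {M : Type*} [TopologicalSpace M] [ChartedSpace (R m) M]
    (η : DForm (R m) M m) : Prop where
  smooth : η.IsSmooth
  ne_zero : ∀ x, η x ≠ 0

/-- The coordinate basis of `T_x M` in the preferred chart at `x`. -/
def tangentBasis {m : ℕ} {M : Type*} [TopologicalSpace M] [ChartedSpace (R m) M] (x : M)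
    (μ : Fin m) : TangentSpace (𝓡 m) x :=
  (EuclideanSpace.single μ 1 : R m)

/-- The dual basis of `tangentBasis`. -/
def cotangentBasis {m : ℕ} {M : Type*} [TopologicalSpace M] [ChartedSpace (R m) M] (x : M)
    (μ : Fin m) : TangentSpace (𝓡 m) x →L[ℝ] ℝ :=
  (EuclideanSpace.proj μ : R m →L[ℝ] ℝ)

/-- The `m`-vector `Z` at `x` with `η(Z) = 1`. -/
def unitMultivector {m : ℕ} {M : Type*} [TopologicalSpace M] [ChartedSpace (R m) M]
    (η : DForm (R m) M m) (x : M) : ⋀[ℝ]^m (TangentSpace (𝓡 m) x) :=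
  (η x (tangentBasis x))⁻¹ • exteriorPower.ιMulti ℝ m (tangentBasis x)

/-- An Ehresmann connection in a fibration `κ : N → Q`, given by its horizontal lifts
`T_{κ y} Q → T_y N`, depending smoothly on `y`; their images are the horizontal subspaces. -/
structure EhresmannConnection [IsManifold 𝓘(ℝ, V) ∞ N] [IsManifold 𝓘(ℝ, W) ∞ Q]
    (κ : N → Q) where
  /-- the horizontal lift at `y` -/
  lift : (y : N) → TangentSpace 𝓘(ℝ, W) (κ y) →L[ℝ] TangentSpace 𝓘(ℝ, V) y
  mfderiv_comp_lift : ∀ y, (mfderiv 𝓘(ℝ, V) 𝓘(ℝ, W) κ y).comp (lift y) =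
    ContinuousLinearMap.id ℝ (TangentSpace 𝓘(ℝ, W) (κ y))
  smooth : ∀ y₀, ContMDiffAt 𝓘(ℝ, V) 𝓘(ℝ, W →L[ℝ] V) ∞
    (inTangentCoordinates 𝓘(ℝ, W) 𝓘(ℝ, V) κ id lift y₀) y₀

namespace EhresmannConnection

variable [IsManifold 𝓘(ℝ, V) ∞ N] [IsManifold 𝓘(ℝ, W) ∞ Q] {κ : N → Q}

/-- The projection of `T_y N = H_y ⊕ V_y` onto the horizontal subspace. -/
def horProj (C : EhresmannConnection (V := V) (W := W) κ) (y : N) :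
    TangentSpace 𝓘(ℝ, V) y →L[ℝ] TangentSpace 𝓘(ℝ, V) y :=
  (C.lift y).comp (mfderiv 𝓘(ℝ, V) 𝓘(ℝ, W) κ y)

/-- The projection of `T_y N = H_y ⊕ V_y` onto the vertical subspace. -/
def verProj (C : EhresmannConnection (V := V) (W := W) κ) (y : N) :
    TangentSpace 𝓘(ℝ, V) y →L[ℝ] TangentSpace 𝓘(ℝ, V) y :=
  ContinuousLinearMap.id ℝ _ - C.horProj y

/-- The component of bidegree `(p, k - p)` of a `k`-form `α`, that is, its component in
`Λᵖ H^* ⊗ Λ^{k-p} V^*`. By multilinearity, `α` is the sum of these components. -/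
def bidegreePart (C : EhresmannConnection (V := V) (W := W) κ) (p : ℕ) (α : DForm V N k) :
    DForm V N k := fun y => mixedPart p (α y) (C.horProj y) (C.verProj y)

/-- A `k`-form has bidegree `(p, q)`, with `p + q = k`, if it equals its component of this
bidegree. -/
def HasBidegree (C : EhresmannConnection (V := V) (W := W) κ) (p q : ℕ) (α : DForm V N k) : Prop :=
  p + q = k ∧ C.bidegreePart p α = α

/-- The `m`-vector field associated with a connection and a volume form: the horizontal lift of
the `m`-vector `Z` with `η(Z) = 1`. -/
def multivector {m : ℕ} {M : Type*} [TopologicalSpace M] [ChartedSpace (R m) M]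
    [IsManifold (𝓡 m) ∞ M] {κ : N → M} (C : EhresmannConnection (V := V) (W := R m) κ)
    (η : DForm (R m) M m) (y : N) : ⋀[ℝ]^m (TangentSpace 𝓘(ℝ, V) y) :=
  exteriorPower.map m (C.lift y).toLinearMap (unitMultivector η (κ y))

/-- The 1-form `i(Y)α`, `Y` being the `m`-vector field associated with the connection and `η`. -/
def gammaForm [FiniteDimensional ℝ V] {m : ℕ} {M : Type*} [TopologicalSpace M]
    [ChartedSpace (R m) M] [IsManifold (𝓡 m) ∞ M] {κ : N → M}
    (C : EhresmannConnection (V := V) (W := R m) κ) (η : DForm (R m) M m)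
    (α : DForm V N (m + 1)) : DForm V N 1 :=
  fun y => contract (C.multivector η y) (α y)

/-- The form `α^∇`, consisting of all the components of `α` but the one of bidegree `(m, 1)`. -/
def remainder (C : EhresmannConnection (V := V) (W := W) κ) {m : ℕ} (α : DForm V N (m + 1)) :
    DForm V N (m + 1) :=
  α - C.bidegreePart m α

end EhresmannConnection

end Forms

section Lagrangian

variable {m n : ℕ} {M E : Type*} [TopologicalSpace M] [ChartedSpace (R m) M]
  [TopologicalSpace E] [ChartedSpace (R (m + n)) E]
  {π : FibredManifold m n M E}

/-- The projection `J¹π → M`. -/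
def Jet.toBase (j : Jet π) : M := π.proj j.point

/-- The space `T_x^* M ⊗ V_e π` of linear maps `T_x M → T_e E`, `x = π e`, with values in the
vertical space `V_e π`. -/
def vertHom (π : FibredManifold m n M E) (e : E) : Submodule ℝ (R m →L[ℝ] R (m + n)) where
  carrier := {u | (AdaptedChart.dProj π e).comp u = 0}
  add_mem' {u v} hu hv := by
    have hu' : (AdaptedChart.dProj π e).comp u = 0 := hu
    have hv' : (AdaptedChart.dProj π e).comp v = 0 := hv
    simp [hu', hv']
  zero_mem' := by simp
  smul_mem' a u hu := by
    have hu' : (AdaptedChart.dProj π e).comp u = 0 := hu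
    change (AdaptedChart.dProj π e).comp (a • u) = 0
    rw [ContinuousLinearMap.comp_smul, hu']
    exact smul_zero (A := R m →L[ℝ] R m) a

/-- The affine structure of the fibres of `J¹π → E`: the 1-jet `j + u`. -/
def Jet.translate (j : Jet π) (u : vertHom π j.point) : Jet π where
  point := j.point
  lift := (j.tangent + u.1 : R m →L[ℝ] R (m + n))
  mfderiv_comp_lift := by
    have h1 := j.dProj_comp_tangent
    have h2 : (AdaptedChart.dProj π j.point).comp u.1 = 0 := u.2
    change (AdaptedChart.dProj π j.point).comp (j.tangent + u.1) = .id ℝ (R m)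
    rw [ContinuousLinearMap.comp_add, h1, h2, add_zero]

/-- The vertical lift `T_x^* M ⊗ V_e π → T_j J¹π`, which sends `u` to the velocity at `t = 0` of the
curve `t ↦ j + t u`. -/
def Jet.vertLift (j : Jet π) :
    vertHom π j.point →L[ℝ] TangentSpace 𝓘(ℝ, JetModel m n) j :=
  mfderiv 𝓘(ℝ, vertHom π j.point) 𝓘(ℝ, JetModel m n) j.translate 0

/-- The contact form (structure canonical form) of `J¹π`: at the 1-jet `j` of `φ` it is
`X ↦ Tπ¹ X - Tφ (Tπ̄¹ X)`, in coordinates `(dy^A - v^A_α dx^α) ⊗ ∂/∂y^A`. -/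
def Jet.contact (j : Jet π) : TangentSpace 𝓘(ℝ, JetModel m n) j →L[ℝ] R (m + n) :=
  let d : JetModel m n →L[ℝ] R (m + n) :=
    mfderiv 𝓘(ℝ, JetModel m n) (𝓡 (m + n)) (Jet.point (π := π)) j
  d - j.tangent.comp ((AdaptedChart.dProj π j.point).comp d)

theorem Jet.dProj_contact (j : Jet π) (X : TangentSpace 𝓘(ℝ, JetModel m n) j) :
    AdaptedChart.dProj π j.point (j.contact X) = 0 := by
  set d : JetModel m n →L[ℝ] R (m + n) :=
    mfderiv 𝓘(ℝ, JetModel m n) (𝓡 (m + n)) (Jet.point (π := π)) j with hd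
  have h (w : R m) : AdaptedChart.dProj π j.point (j.tangent w) = w :=
    DFunLike.congr_fun j.dProj_comp_tangent w
  change AdaptedChart.dProj π j.point
    (d X - j.tangent (AdaptedChart.dProj π j.point (d X))) = 0
  rw [map_sub, h, sub_self]

/-- The vertical endomorphism `𝒱` of `J¹π`, in coordinates
`(dy^A - v^A_α dx^α) ⊗ ∂/∂v^A_ν ⊗ ∂/∂x^ν`, as a map that sends a covector `a ∈ T_x^* M` to the
endomorphism `X ↦ (a ⊗ contact X)^{lift}` of `T_j J¹π`. -/
def Jet.verticalEndo (j : Jet π) (a : TangentSpace (𝓡 m) j.toBase →L[ℝ] ℝ) :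
    TangentSpace 𝓘(ℝ, JetModel m n) j →L[ℝ] TangentSpace 𝓘(ℝ, JetModel m n) j :=
  j.vertLift.comp
    (((ContinuousLinearMap.smulRightL ℝ (R m) (R (m + n)) a).comp j.contact).codRestrict
      (vertHom π j.point) (by
        intro X
        refine ContinuousLinearMap.ext fun (w : R m) => ?_
        have h := j.dProj_contact X
        change AdaptedChart.dProj π j.point
          ((a : R m →L[ℝ] ℝ) w • (j.contact X : R (m + n))) = 0
        rw [map_smul, h, smul_zero]))

variable (η : DForm (R m) M m) (L : Jet π → ℝ)

/-- The pullback `ω` of the volume form to `J¹π`. -/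
def omegaForm : DForm (JetModel m n) (Jet π) m := η.pullback Jet.toBase

/-- The Lagrangian density `ℒ = L ω`. -/
def lagrangianDensity : DForm (JetModel m n) (Jet π) m := fun j => L j • omegaForm η j

/-- The contraction of the vertical endomorphism with `dL`,
`∂L/∂v^A_ν (dy^A - v^A_α dx^α) ⊗ ∂/∂x^ν`, as a linear map `T_j J¹π → T_x M`. -/
def momentumMap (j : Jet π) :
    TangentSpace 𝓘(ℝ, JetModel m n) j →L[ℝ] TangentSpace (𝓡 m) j.toBase :=
  let dL : TangentSpace 𝓘(ℝ, JetModel m n) j →L[ℝ] ℝ := mfderiv 𝓘(ℝ, JetModel m n) 𝓘(ℝ, ℝ) L j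
  ∑ μ : Fin m, (dL.comp (j.verticalEndo (cotangentBasis j.toBase μ))).smulRight
    (tangentBasis j.toBase μ)

/-- The contraction `i(𝒱)ℒ`, in coordinates `∂L/∂v^A_ν (dy^A - v^A_α dx^α) ∧ i(∂/∂x^ν) ω`: the sum
over the positions `i` of `η` evaluated on the projections of the `X_k` to `M`, with
`momentumMap X_i` in the `i`-th position. -/
def contractVerticalEndo : DForm (JetModel m n) (Jet π) m := fun j =>
  mixedPart 1 (η j.toBase) (momentumMap L j)
    (mfderiv 𝓘(ℝ, JetModel m n) (𝓡 m) (Jet.toBase (π := π)) j)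

/-- The Poincaré–Cartan `m`-form `Θ_ℒ = i(𝒱)ℒ + ℒ`. -/
def poincareCartanTheta : DForm (JetModel m n) (Jet π) m :=
  contractVerticalEndo η L + lagrangianDensity η L

/-- The Poincaré–Cartan `(m+1)`-form `Ω_ℒ = -dΘ_ℒ`. -/
def poincareCartanOmega : DForm (JetModel m n) (Jet π) (m + 1) :=
  -(poincareCartanTheta η L).extDeriv

end Lagrangian

end FieldTheory

end

/-!
Contracting with the vertical endomorphism replaces one factor of the semibasic form `ω` by a
contact form, so `Θ_ℒ` vanishes on two `π̄¹`-vertical vectors; the exterior derivative raises this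
number by one, so `Ω_ℒ` vanishes on three. In the bigrading of any connection only the components
of bidegrees `(m + 1, 0)`, `(m, 1)` and `(m - 1, 2)` are left, and the first is zero because the
horizontal spaces have dimension `m`. The component of bidegree `(m, 1)` is `ω ∧ γ`: its horizontal
part is a top-degree form on an `m`-dimensional space, hence determined by its value on the lift of
the `m`-vector normalized by `η`.

Smoothness of a form is checked in one chart around each point. There the lifts of a connection and
`Θ_ℒ` have explicit coordinate expressions, and `γ` is a quotient of evaluations of `Ω_ℒ` and `η`.
-/

noncomputable section

namespace FieldTheory

section Algebra

open scoped Nat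

variable {T : Type*} [AddCommGroup T] [Module ℝ T] {k l m : ℕ}

theorem factorial_mul_factorial_mul_wedge_apply (α : T [⋀^Fin k]→ₗ[ℝ] ℝ)
    (β : T [⋀^Fin l]→ₗ[ℝ] ℝ) (v : Fin (k + l) → T) :
    (k ! * l ! : ℝ) * wedge α β v = ∑ σ : Equiv.Perm (Fin (k + l)), Equiv.Perm.sign σ •
      (α (fun i => v (σ (Fin.castAdd l i))) * β fun i => v (σ (Fin.natAdd k i))) := by
  have halt := congrArg (fun g => LinearMap.mul' ℝ ℝ (g (v ∘ finSumFinEquiv)))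
    (MultilinearMap.domCoprod_alternization_eq α β)
  simp only [Fintype.card_fin] at halt
  have hwedge : (k ! * l ! : ℝ) * wedge α β v =
      LinearMap.mul' ℝ ℝ (((k ! * l !) • α.domCoprod β) (v ∘ finSumFinEquiv)) := by
    rw [AlternatingMap.smul_apply, map_nsmul, nsmul_eq_mul, Nat.cast_mul]
    rfl
  rw [hwedge, ← halt, MultilinearMap.alternatization_apply, map_sum,
    ← Equiv.sum_comp (finSumFinEquiv (m := k) (n := l)).permCongr]
  refine Finset.sum_congr rfl fun σ _ => ?_
  rw [Equiv.Perm.sign_permCongr, Units.smul_def, map_zsmul, ← Units.smul_def]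
  simp only [Equiv.permCongr_apply, finSumFinEquiv_symm_apply_castAdd,
    finSumFinEquiv_symm_apply_natAdd]
  rfl

theorem sum_perm_apply_last {A : Type*} [AddCommMonoid A] (g : Fin (m + 1) → A) :
    ∑ σ : Equiv.Perm (Fin (m + 1)), g (σ (Fin.last m)) = m ! • ∑ i, g i := by
  rw [← Equiv.sum_comp (Equiv.mulRight (Equiv.swap 0 (Fin.last m)))]
  simp only [Equiv.coe_mulRight, Equiv.Perm.mul_apply, Equiv.swap_apply_right]
  rw [← Equiv.Perm.decomposeFin.symm.sum_comp, Fintype.sum_prod_type]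
  simp [Fintype.card_perm, Finset.smul_sum]

theorem apply_mul_apply_basis_comm {S P ι : Type*} [CommRing S] [AddCommGroup P]
    [Module S P] [Finite ι] (b : Module.Basis ι S P) (f g : P [⋀^ι]→ₗ[S] S) (x : ι → P) :
    f x * g b = g x * f b := by
  classical
  have := Fintype.ofFinite ι
  rw [f.eq_smul_basis_det b, g.eq_smul_basis_det b]
  simp only [AlternatingMap.smul_apply, smul_eq_mul, b.det_self, mul_one]
  ring

end Algebra

section Alternating

variable {T T' U U' W : Type*} [AddCommGroup T] [Module ℝ T] [TopologicalSpace T]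
  [AddCommGroup T'] [Module ℝ T'] [TopologicalSpace T'] [AddCommGroup U] [Module ℝ U]
  [TopologicalSpace U] [AddCommGroup U'] [Module ℝ U'] [TopologicalSpace U']
  [AddCommGroup W] [Module ℝ W] [TopologicalSpace W] {k m p q r s : ℕ}

/-- The form `f` vanishes as soon as `r` of its arguments lie in `K`, that is,
`i(Z₁) ⋯ i(Z_r) f = 0` for all `Z₁, …, Z_r` in `K`. -/
def VanishesOn (K : Submodule ℝ T) (r : ℕ) (f : T [⋀^Fin k]→L[ℝ] ℝ) : Prop :=
  ∀ (S : Finset (Fin k)) (v : Fin k → T), S.card = r → (∀ i ∈ S, v i ∈ K) → f v = 0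

namespace VanishesOn

variable {K : Submodule ℝ T} {f g : T [⋀^Fin k]→L[ℝ] ℝ}

theorem mono (h : VanishesOn K r f) (hrs : r ≤ s) : VanishesOn K s f := fun _ v hS hv => by
  obtain ⟨S', hS', hcard⟩ := Finset.exists_subset_card_eq (hrs.trans_eq hS.symm)
  exact h S' v hcard fun i hi => hv i (hS' hi)

theorem add (hf : VanishesOn K r f) (hg : VanishesOn K r g) : VanishesOn K r (f + g) :=
  fun S v hS hv => by
    rw [ContinuousAlternatingMap.add_apply, hf S v hS hv, hg S v hS hv, add_zero]

theorem smul (c : ℝ) (hf : VanishesOn K r f) : VanishesOn K r (c • f) :=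
  fun S v hS hv => by rw [ContinuousAlternatingMap.smul_apply, hf S v hS hv, smul_zero]

theorem neg (hf : VanishesOn K r f) : VanishesOn K r (-f) :=
  fun S v hS hv => by rw [ContinuousAlternatingMap.neg_apply, hf S v hS hv, neg_zero]

theorem compContinuousLinearMap {A : T' →L[ℝ] T} {K' : Submodule ℝ T'} (hf : VanishesOn K r f)
    (hA : K' ≤ K.comap A.toLinearMap) : VanishesOn K' r (f.compContinuousLinearMap A) :=
  fun S _ hS hv => hf S _ hS fun i hi => hA (hv i hi)

theorem mixedPart_eq_zero (h : VanishesOn K q f) {A B : T' →L[ℝ] T} (hB : ∀ v, B v ∈ K)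
    (hpq : p + q ≤ k) : mixedPart p f A B = 0 := by
  ext v
  rw [mixedPart_apply]
  refine Finset.sum_eq_zero fun S hS => ?_
  have hcard : q ≤ Sᶜ.card := by
    rw [Finset.card_compl, (Finset.mem_powersetCard.1 hS).2, Fintype.card_fin]
    omega
  obtain ⟨S', hS', hS'q⟩ := Finset.exists_subset_card_eq hcard
  refine h S' _ hS'q fun i hi => ?_
  rw [if_neg (Finset.mem_compl.1 (hS' hi))]
  exact hB _

end VanishesOn

theorem vanishesOn_ker_mixedPart (p : ℕ) (f : T' [⋀^Fin k]→L[ℝ] ℝ) (A B : T →L[ℝ] T') :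
    VanishesOn B.ker (p + 1) (mixedPart p f A B) := fun S v hS hv => by
  rw [mixedPart_apply]
  refine Finset.sum_eq_zero fun S' hS' => ?_
  obtain ⟨i, hi, hi'⟩ : ∃ i ∈ S, i ∉ S' := Finset.exists_mem_notMem_of_card_lt_card
    (by rw [hS, (Finset.mem_powersetCard.1 hS').2]; exact p.lt_succ_self)
  exact f.map_coord_zero i (by rw [if_neg hi']; exact hv i hi)

theorem vanishesOn_ker_compContinuousLinearMap (f : T' [⋀^Fin k]→L[ℝ] ℝ) (A : T →L[ℝ] T') :
    VanishesOn A.ker 1 (f.compContinuousLinearMap A) := fun S v hS hv => by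
  obtain ⟨i, rfl⟩ := Finset.card_eq_one.1 hS
  exact f.map_coord_zero i (hv i (Finset.mem_singleton_self i))

theorem mixedPart_mixedPart_self (p : ℕ) (f : T [⋀^Fin k]→L[ℝ] ℝ) {A B : T →L[ℝ] T}
    (hA : A.comp A = A) (hB : B.comp B = B) (hAB : A.comp B = 0) :
    mixedPart p (mixedPart p f A B) A B = mixedPart p f A B := by
  have hA' (v : T) : A (A v) = A v := DFunLike.congr_fun hA v
  have hB' (v : T) : B (B v) = B v := DFunLike.congr_fun hB v
  have hAB' (v : T) : A (B v) = 0 := DFunLike.congr_fun hAB v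
  ext v
  rw [mixedPart_apply, mixedPart_apply]
  refine Finset.sum_congr rfl fun S hS => ?_
  rw [mixedPart_apply, Finset.sum_eq_single_of_mem S hS]
  · congr 1
    funext i
    split_ifs
    · exact hA' _
    · exact hB' _
  · intro S' hS' hne
    obtain ⟨i, hi, hi'⟩ : ∃ i ∈ S', i ∉ S := by
      by_contra! h
      exact hne (Finset.eq_of_subset_of_card_le h
        (by rw [(Finset.mem_powersetCard.1 hS).2, (Finset.mem_powersetCard.1 hS').2]))
    exact f.map_coord_zero i (by rw [if_pos hi, if_neg hi', hAB'])

theorem sum_mixedPart [ContinuousAdd T] (f : T [⋀^Fin k]→L[ℝ] ℝ) {A B : T →L[ℝ] T}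
    (h : A + B = .id ℝ T) : ∑ p ∈ Finset.range (k + 1), mixedPart p f A B = f := by
  ext v
  have hv : A ∘ v + B ∘ v = v := funext fun i => DFunLike.congr_fun h (v i)
  have hexpand : f v = ∑ S : Finset (Fin k), f (S.piecewise (A ∘ v) (B ∘ v)) := by
    conv_lhs => rw [← hv]
    exact f.toMultilinearMap.map_add_univ _ _
  have hcard (S : Finset (Fin k)) : S.card ∈ Finset.range (k + 1) :=
    Finset.mem_range_succ_iff.2 (card_finset_fin_le S)
  rw [ContinuousAlternatingMap.sum_apply, hexpand,
    ← Finset.sum_fiberwise_of_maps_to fun S _ => hcard S]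
  refine Finset.sum_congr rfl fun p _ => ?_
  rw [mixedPart_apply, ← Finset.univ_filter_card_eq]
  rfl

theorem mixedPart_mixedPart_self_of_comp_eq_id [IsTopologicalAddGroup T] (p : ℕ)
    (f : T [⋀^Fin k]→L[ℝ] ℝ) {L : W →L[ℝ] T} {d : T →L[ℝ] W} (hdL : d.comp L = .id ℝ W) :
    mixedPart p (mixedPart p f (L.comp d) (.id ℝ T - L.comp d)) (L.comp d) (.id ℝ T - L.comp d) =
      mixedPart p f (L.comp d) (.id ℝ T - L.comp d) := by
  have hidem : (L.comp d).comp (L.comp d) = L.comp d := by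
    rw [ContinuousLinearMap.comp_assoc, ← ContinuousLinearMap.comp_assoc d L d, hdL,
      ContinuousLinearMap.id_comp]
  refine mixedPart_mixedPart_self p f hidem ?_ ?_
  · simp only [ContinuousLinearMap.comp_sub, ContinuousLinearMap.sub_comp,
      ContinuousLinearMap.id_comp, ContinuousLinearMap.comp_id, hidem, sub_self, sub_zero]
  · rw [ContinuousLinearMap.comp_sub, ContinuousLinearMap.comp_id, hidem, sub_self]

theorem mixedPart_compContinuousLinearMap (p : ℕ) (f : T' [⋀^Fin k]→L[ℝ] ℝ) {A B : T →L[ℝ] T'}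
    {A' B' : U →L[ℝ] U'} {D : U →L[ℝ] T} {D' : U' →L[ℝ] T'}
    (hA : A.comp D = D'.comp A') (hB : B.comp D = D'.comp B') :
    (mixedPart p f A B).compContinuousLinearMap D =
      mixedPart p (f.compContinuousLinearMap D') A' B' := by
  ext v
  rw [ContinuousAlternatingMap.compContinuousLinearMap_apply, mixedPart_apply, mixedPart_apply]
  refine Finset.sum_congr rfl fun S _ => congrArg f (funext fun i => ?_)
  dsimp only [Function.comp_apply]
  split_ifs
  · exact DFunLike.congr_fun hA (v i)
  · exact DFunLike.congr_fun hB (v i)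

theorem mixedPart_succ_apply (f : T' [⋀^Fin (m + 1)]→L[ℝ] ℝ) (A B : T →L[ℝ] T')
    (v : Fin (m + 1) → T) :
    mixedPart m f A B v = ∑ i, f (Function.update (A ∘ v) i (B (v i))) := by
  rw [mixedPart_apply]
  symm
  refine Finset.sum_bij (fun i _ => {i}ᶜ) (fun i _ => ?_) (fun i _ j _ hij => ?_)
    (fun S hS => ?_) fun i _ => congrArg f (funext fun j => ?_)
  · simp [Finset.mem_powersetCard, Finset.card_compl]
  · simpa using hij
  · obtain ⟨i, hi⟩ : ∃ i, Sᶜ = {i} := Finset.card_eq_one.1 (by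
      rw [Finset.card_compl, (Finset.mem_powersetCard.1 hS).2, Fintype.card_fin]
      omega)
    exact ⟨i, Finset.mem_univ _, by rw [← hi, compl_compl]⟩
  · by_cases hj : j = i
    · subst hj; simp
    · simp [hj]

theorem mixedPart_top (f : T' [⋀^Fin k]→L[ℝ] ℝ) (A B : T →L[ℝ] T') :
    mixedPart k f A B = f.compContinuousLinearMap A := by
  ext v
  have huniv : Finset.powersetCard k (Finset.univ : Finset (Fin k)) = {Finset.univ} := by
    simpa using Finset.powersetCard_self (Finset.univ : Finset (Fin k))
  rw [mixedPart_apply, huniv, Finset.sum_singleton]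
  simp only [Finset.mem_univ, if_true]
  rfl

theorem wedge_one_eq_mixedPart {α : T [⋀^Fin m]→ₗ[ℝ] ℝ} {β : T [⋀^Fin 1]→ₗ[ℝ] ℝ}
    {f : T' [⋀^Fin (m + 1)]→L[ℝ] ℝ} {A B : T →L[ℝ] T'}
    (h : ∀ v : Fin (m + 1) → T, α (fun i => v i.castSucc) * β (fun _ => v (Fin.last m)) =
      f (Function.update (A ∘ v) (Fin.last m) (B (v (Fin.last m))))) :
    wedge α β = (mixedPart m f A B).toAlternatingMap := by
  ext v
  have hterm (σ : Equiv.Perm (Fin (m + 1))) : Equiv.Perm.sign σ •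
      (α (fun i => v (σ (Fin.castAdd 1 i))) * β fun i => v (σ (Fin.natAdd m i))) =
        f (Function.update (A ∘ v) (σ (Fin.last m)) (B (v (σ (Fin.last m))))) := by
    have hlast (i : Fin 1) : Fin.natAdd m i = Fin.last m := by
      rw [Subsingleton.elim i 0]; rfl
    have hperm := f.toAlternatingMap.map_perm
      (Function.update (A ∘ v) (σ (Fin.last m)) (B (v (σ (Fin.last m))))) σ
    rw [Function.update_comp_eq_of_injective _ σ.injective] at hperm
    simp only [hlast]
    refine (congrArg _ ((h (v ∘ σ)).trans hperm)).trans ?_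
    rw [smul_smul, Int.units_mul_self, one_smul]
    rfl
  have hsum := factorial_mul_factorial_mul_wedge_apply α β v
  rw [Finset.sum_congr rfl fun σ _ => hterm σ,
    sum_perm_apply_last fun i => f (Function.update (A ∘ v) i (B (v i))), Nat.factorial_one,
    Nat.cast_one, mul_one, nsmul_eq_mul, ← mixedPart_succ_apply] at hsum
  exact mul_left_cancel₀ (Nat.cast_ne_zero.2 m.factorial_ne_zero) hsum

theorem compContinuousLinearMap_eq_zero_of_finrank_lt [FiniteDimensional ℝ W]
    (hk : Module.finrank ℝ W < k) (f : T [⋀^Fin k]→L[ℝ] ℝ) (L : W →L[ℝ] T) :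
    f.compContinuousLinearMap L = 0 := by
  ext x
  refine (f.compContinuousLinearMap L).toAlternatingMap.map_linearDependent x fun h => ?_
  simpa [hk.not_ge] using h.fintype_card_le_finrank

theorem apply_snoc_eq (f : T [⋀^Fin (m + 1)]→L[ℝ] ℝ) (w : Fin m → T) (u : T) :
    f (Fin.snoc (α := fun _ => T) w u) = (-1 : ℝ) ^ m * f (Matrix.vecCons u w) := by
  have h := f.toAlternatingMap.map_perm (Matrix.vecCons u w) (finRotate (m + 1))
  rw [sign_finRotate, Nat.add_sub_cancel] at h
  refine (congrArg f (Fin.snoc_eq_cons_rotate _ _)).trans (h.trans ?_)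
  simp [Units.smul_def]

section Contract

variable [IsTopologicalAddGroup T] [ContinuousSMul ℝ T] [T2Space T] [FiniteDimensional ℝ T]

theorem contract_smul_ιMulti_apply (f : T [⋀^Fin (m + 1)]→L[ℝ] ℝ) (c : ℝ) (w : Fin m → T)
    (u : Fin 1 → T) : contract (c • exteriorPower.ιMulti ℝ m w) f u =
      c * f (Fin.snoc (α := fun _ => T) w (u 0)) := by
  rw [apply_snoc_eq]
  change (-1 : ℝ) ^ m * exteriorPower.alternatingMapLinearEquiv
    (f.toAlternatingMap.curryLeft (u 0)) (c • exteriorPower.ιMulti ℝ m w) = _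
  rw [map_smul, exteriorPower.alternatingMapLinearEquiv_apply_ιMulti, smul_eq_mul,
    mul_left_comm]
  rfl

theorem mul_contract_map_apply (b : Module.Basis (Fin m) ℝ W) {η : W [⋀^Fin m]→L[ℝ] ℝ}
    (hη : η ≠ 0) (f : T [⋀^Fin (m + 1)]→L[ℝ] ℝ) (L : W →L[ℝ] T) (x : Fin m → W) (u : Fin 1 → T) :
    η x * contract (exteriorPower.map m L.toLinearMap
      ((η b)⁻¹ • exteriorPower.ιMulti ℝ m b)) f u =
      f (Fin.snoc (α := fun _ => T) (L ∘ x) (u 0)) := by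
  have hηb : η b ≠ 0 := fun h => hη (ContinuousAlternatingMap.toAlternatingMap_injective
    ((AlternatingMap.map_basis_eq_zero_iff b η.toAlternatingMap).1 h))
  have hprop : η x * f (Matrix.vecCons (u 0) (L ∘ b)) = f (Matrix.vecCons (u 0) (L ∘ x)) * η b :=
    apply_mul_apply_basis_comm b η.toAlternatingMap
      ((f.toAlternatingMap.curryLeft (u 0)).compLinearMap L.toLinearMap) x
  rw [map_smul, exteriorPower.map_apply_ιMulti, contract_smul_ιMulti_apply, apply_snoc_eq,
    apply_snoc_eq]
  change η x * ((η b)⁻¹ * ((-1) ^ m * f (Matrix.vecCons (u 0) (L ∘ b)))) = _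
  field_simp
  linear_combination hprop

theorem wedge_contract_eq_mixedPart (b : Module.Basis (Fin m) ℝ W) {η : W [⋀^Fin m]→L[ℝ] ℝ}
    (hη : η ≠ 0) (f : T [⋀^Fin (m + 1)]→L[ℝ] ℝ) (L : W →L[ℝ] T) (d : T →L[ℝ] W) :
    wedge (η.compContinuousLinearMap d).toAlternatingMap
      (contract (exteriorPower.map m L.toLinearMap
        ((η b)⁻¹ • exteriorPower.ιMulti ℝ m b)) f).toAlternatingMap =
      (mixedPart m f (L.comp d) (.id ℝ T - L.comp d)).toAlternatingMap := by
  have := b.finiteDimensional_of_finite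
  refine wedge_one_eq_mixedPart fun v => ?_
  refine (mul_contract_map_apply b hη f L (fun i => d (v i.castSucc)) _).trans ?_
  have hsnoc (z : T) : Fin.snoc (α := fun _ => T) (L ∘ fun i => d (v i.castSucc)) z =
      Function.update (L.comp d ∘ v) (Fin.last m) z := by
    funext i
    refine Fin.lastCases ?_ (fun j => ?_) i
    · simp
    · simp [Fin.castSucc_ne_last]
  have hhor : f (L.comp d ∘ v) = 0 := DFunLike.congr_fun
    (compContinuousLinearMap_eq_zero_of_finrank_lt
      (by rw [Module.finrank_eq_card_basis b, Fintype.card_fin]; exact m.lt_succ_self) f L) (d ∘ v)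
  rw [hsnoc, _root_.sub_apply, f.map_update_sub, sub_eq_self.2]
  · rfl
  · exact (congrArg f (Function.update_eq_self (Fin.last m) (L.comp d ∘ v))).trans hhor

end Contract

theorem sub_mixedPart_eq_mixedPart [IsTopologicalAddGroup T] [FiniteDimensional ℝ W]
    (hW : Module.finrank ℝ W = m) (hm : 1 ≤ m) {f : T [⋀^Fin (m + 1)]→L[ℝ] ℝ} {L : W →L[ℝ] T}
    {d : T →L[ℝ] W} (hdL : d.comp L = .id ℝ W) (hf : VanishesOn d.ker 3 f) :
    f - mixedPart m f (L.comp d) (.id ℝ T - L.comp d) =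
      mixedPart (m - 1) f (L.comp d) (.id ℝ T - L.comp d) := by
  obtain ⟨m, rfl⟩ := Nat.exists_eq_add_of_le' hm
  have htop : mixedPart (m + 2) f (L.comp d) (.id ℝ T - L.comp d) = 0 := by
    rw [mixedPart_top]
    ext v
    exact DFunLike.congr_fun (compContinuousLinearMap_eq_zero_of_finrank_lt (by omega) f L) (d ∘ v)
  have hlow (p : ℕ) (hp : p ∈ Finset.range m) :
      mixedPart p f (L.comp d) (.id ℝ T - L.comp d) = 0 := by
    refine hf.mixedPart_eq_zero (fun v => ?_) (by have := Finset.mem_range.1 hp; omega)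
    have hv : d (L (d v)) = d v := DFunLike.congr_fun hdL (d v)
    change d (v - L (d v)) = 0
    rw [map_sub, hv, sub_self]
  refine sub_eq_of_eq_add ((sum_mixedPart f (add_sub_cancel (L.comp d) (.id ℝ T))).symm.trans ?_)
  rw [Finset.sum_range_succ, Finset.sum_range_succ, Finset.sum_range_succ,
    Finset.sum_eq_zero hlow, htop, zero_add, add_zero, Nat.add_sub_cancel]

end Alternating

section Analysis

open scoped Topology

variable {V W X : Type*} [NormedAddCommGroup V] [NormedSpace ℝ V] [NormedAddCommGroup W]
  [NormedSpace ℝ W] [NormedAddCommGroup X] [NormedSpace ℝ X] {k p r : ℕ} {n : WithTop ℕ∞} {x : X}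

theorem contDiffAt_alternatingMap_of_apply [FiniteDimensional ℝ V] {f : X → V [⋀^Fin k]→L[ℝ] ℝ}
    (h : ∀ v, ContDiffAt ℝ n (fun z => f z v) x) : ContDiffAt ℝ n f x := by
  let b := Module.finBasis ℝ V
  let evalBasis : (V [⋀^Fin k]→L[ℝ] ℝ) →ₗ[ℝ] ((Fin k → Fin (Module.finrank ℝ V)) → ℝ) :=
    { toFun := fun g i => g (b ∘ i)
      map_add' := fun _ _ => rfl
      map_smul' := fun _ _ => rfl }
  have hker : LinearMap.ker evalBasis = ⊥ := LinearMap.ker_eq_bot.2 fun g g' hg =>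
    ContinuousAlternatingMap.toAlternatingMap_injective
      (AlternatingMap.coe_multilinearMap_injective
        (Module.Basis.ext_multilinear (fun _ => b) fun i => congrFun hg i))
  obtain ⟨s, hs⟩ := evalBasis.exists_leftInverse_of_injective hker
  have hsf : (fun z => s.toContinuousLinearMap (evalBasis (f z))) = f :=
    funext fun z => DFunLike.congr_fun hs (f z)
  rw [← hsf]
  exact s.toContinuousLinearMap.contDiff.contDiffAt.comp x (contDiffAt_pi.2 fun i => h (b ∘ i))

theorem contDiffAt_alternatingMap_apply {f : X → V [⋀^Fin k]→L[ℝ] ℝ} {u : X → Fin k → V}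
    (hf : ContDiffAt ℝ n f x) (hu : ∀ i, ContDiffAt ℝ n (fun z => u z i) x) :
    ContDiffAt ℝ n (fun z => f z (u z)) x := by
  let eval : ContinuousMultilinearMap ℝ (fun _ : Fin k => V) ((V [⋀^Fin k]→L[ℝ] ℝ) →L[ℝ] ℝ) :=
    (ContinuousAlternatingMap.toContinuousMultilinearMapCLM ℝ).flipMultilinear
  exact (eval.contDiff.contDiffAt.comp x (contDiffAt_pi.2 hu)).clm_apply hf

theorem contDiffAt_compContinuousLinearMap [FiniteDimensional ℝ V] {f : X → W [⋀^Fin k]→L[ℝ] ℝ}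
    {A : X → V →L[ℝ] W} (hf : ContDiffAt ℝ n f x) (hA : ContDiffAt ℝ n A x) :
    ContDiffAt ℝ n (fun z => (f z).compContinuousLinearMap (A z)) x :=
  contDiffAt_alternatingMap_of_apply fun v =>
    contDiffAt_alternatingMap_apply (u := fun z i => A z (v i)) hf fun _ =>
      hA.clm_apply contDiffAt_const

theorem contDiffAt_mixedPart [FiniteDimensional ℝ V] {f : X → W [⋀^Fin k]→L[ℝ] ℝ}
    {A B : X → V →L[ℝ] W} (hf : ContDiffAt ℝ n f x) (hA : ContDiffAt ℝ n A x)
    (hB : ContDiffAt ℝ n B x) : ContDiffAt ℝ n (fun z => mixedPart p (f z) (A z) (B z)) x := by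
  refine contDiffAt_alternatingMap_of_apply fun v => ?_
  simp only [mixedPart_apply]
  refine ContDiffAt.sum fun S _ => contDiffAt_alternatingMap_apply hf fun i => ?_
  split_ifs
  · exact hA.clm_apply contDiffAt_const
  · exact hB.clm_apply contDiffAt_const

theorem VanishesOn.extDeriv {f : V → V [⋀^Fin k]→L[ℝ] ℝ} {z : V} {K : Submodule ℝ V}
    (hf : DifferentiableAt ℝ f z) (h : ∀ᶠ z' in 𝓝 z, VanishesOn K r (f z')) :
    VanishesOn K (r + 1) (_root_.extDeriv f z) := fun S v hS hv => by
  rw [extDeriv_apply hf]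
  refine Finset.sum_eq_zero fun i _ => ?_
  have hcard : r ≤ (S.preimage i.succAbove i.succAbove_right_injective.injOn).card := by
    have := Finset.card_preimage S i.succAbove i.succAbove_right_injective.injOn
    simp only [Fin.range_succAbove, Set.mem_compl_iff, Set.mem_singleton_iff,
      Finset.filter_ne'] at this
    have := Finset.pred_card_le_card_erase (s := S) (a := i)
    omega
  have hzero : (fun z' => f z' (i.removeNth v)) =ᶠ[𝓝 z] fun _ => 0 := h.mono fun z' hz' =>
    hz'.mono hcard _ _ rfl fun j hj => hv _ (Finset.mem_preimage.1 hj)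
  rw [hzero.fderiv_eq]
  simp

end Analysis

section DifferentialForms

open scoped Topology

variable {V X : Type*} [NormedAddCommGroup V] [NormedSpace ℝ V]
  [NormedAddCommGroup X] [NormedSpace ℝ X]
  {N : Type*} [TopologicalSpace N] [ChartedSpace V N] {k : ℕ} {g : X → N} {p : X} {y₀ y : N} {z : V}

/-- The differential of a map from a normed space to a manifold, as a map of the model spaces. -/
def dMap (V : Type*) [NormedAddCommGroup V] [NormedSpace ℝ V] {N : Type*} [TopologicalSpace N]
    [ChartedSpace V N] (g : X → N) (p : X) : X →L[ℝ] V := mfderiv 𝓘(ℝ, X) 𝓘(ℝ, V) g p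

/-- The differential of the preferred chart at `y₀` in the point `y`, read in the model space. -/
def dChart (V : Type*) [NormedAddCommGroup V] [NormedSpace ℝ V] {N : Type*} [TopologicalSpace N]
    [ChartedSpace V N] (y₀ y : N) : V →L[ℝ] V := mfderiv 𝓘(ℝ, V) 𝓘(ℝ, V) (chartAt V y₀) y

/-- The differential of the inverse of the preferred chart at `y₀`, in the coordinates of the
point `y`. -/
def dChartSymm (V : Type*) [NormedAddCommGroup V] [NormedSpace ℝ V] {N : Type*}
    [TopologicalSpace N] [ChartedSpace V N] (y₀ y : N) : V →L[ℝ] V :=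
  dMap V (chartAt V y₀).symm (chartAt V y₀ y)

theorem comp_eq_comp_of_hasMFDerivAt {W W' : Type*} [NormedAddCommGroup W] [NormedSpace ℝ W]
    [NormedAddCommGroup W'] [NormedSpace ℝ W'] {P P' Q : Type*} [TopologicalSpace P]
    [ChartedSpace W P] [TopologicalSpace P'] [ChartedSpace W' P'] [TopologicalSpace Q]
    [ChartedSpace X Q] {f : P → Q} {f' : P' → Q} {g : N → P} {g' : N → P'} {df : W →L[ℝ] X}
    {df' : W' →L[ℝ] X} {dg : V →L[ℝ] W} {dg' : V →L[ℝ] W'}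
    (hf : HasMFDerivAt 𝓘(ℝ, W) 𝓘(ℝ, X) f (g y) df) (hg : HasMFDerivAt 𝓘(ℝ, V) 𝓘(ℝ, W) g y dg)
    (hf' : HasMFDerivAt 𝓘(ℝ, W') 𝓘(ℝ, X) f' (g' y) df')
    (hg' : HasMFDerivAt 𝓘(ℝ, V) 𝓘(ℝ, W') g' y dg') (h : f ∘ g =ᶠ[𝓝 y] f' ∘ g') :
    df.comp dg = df'.comp dg' :=
  hasMFDerivAt_unique (hf.comp y hg) ((hf'.comp y hg').congr_of_eventuallyEq h)

theorem dMap_eq_of_eq_comp_add {F : Type*} [NormedAddCommGroup F] [NormedSpace ℝ F]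
    {U : Submodule ℝ F} {f : U → N} {dg : X →L[ℝ] V} (A : F →L[ℝ] X)
    (hf : ∀ u : U, f u = g (p + A u.1)) (hg : HasMFDerivAt 𝓘(ℝ, X) 𝓘(ℝ, V) g p dg) (u : U) :
    dMap V f 0 u = dg (A u.1) := by
  have haffine : HasMFDerivAt 𝓘(ℝ, U) 𝓘(ℝ, X) (fun u : U => p + A u.1) 0 (A.comp U.subtypeL) :=
    ((A.comp U.subtypeL).hasFDerivAt.const_add p).hasMFDerivAt
  have hzero : p + A (0 : U).1 = p := by rw [Submodule.coe_zero, map_zero, add_zero]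
  rw [← hzero] at hg
  rw [funext hf]
  exact DFunLike.congr_fun (hg.comp (0 : U) haffine).mfderiv u

namespace DForm

/-- The pullback of a form on a manifold to a normed space, valued in the forms on that space. -/
def pull (α : DForm V N k) (g : X → N) (p : X) : X [⋀^Fin k]→L[ℝ] ℝ :=
  (α (g p) : V [⋀^Fin k]→L[ℝ] ℝ).compContinuousLinearMap (dMap V g p)

theorem apply_congr (α : DForm V N k) {a b : N} (h : a = b) {w w' : Fin k → V} (hw : w = w') :
    (α a : V [⋀^Fin k]→L[ℝ] ℝ) w = (α b : V [⋀^Fin k]→L[ℝ] ℝ) w' := by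
  subst h hw
  rfl

theorem inChart_chartAt (α : DForm V N k) (hy : y ∈ (chartAt V y₀).source) :
    α.inChart y₀ (chartAt V y₀ y) =
      (α y : V [⋀^Fin k]→L[ℝ] ℝ).compContinuousLinearMap (dChartSymm V y₀ y) := by
  ext v
  exact α.apply_congr ((chartAt V y₀).left_inv hy) rfl

theorem pull_congr (α : DForm V N k) {g' : X → N} (h : g =ᶠ[𝓝 p] g') :
    α.pull g p = α.pull g' p := by
  ext v
  exact α.apply_congr h.self_of_nhds (funext fun i =>
    DFunLike.congr_fun (h.mfderiv_eq (I := 𝓘(ℝ, X)) (I' := 𝓘(ℝ, V))) (v i))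

theorem pull_comp {Y : Type*} [NormedAddCommGroup Y] [NormedSpace ℝ Y] (α : DForm V N k)
    {h : Y → X} {q : Y} (hg : MDifferentiableAt 𝓘(ℝ, X) 𝓘(ℝ, V) g (h q))
    (hh : DifferentiableAt ℝ h q) :
    α.pull (g ∘ h) q = (α.pull g (h q)).compContinuousLinearMap (fderiv ℝ h q) := by
  ext v
  have hcomp := mfderiv_comp (I := 𝓘(ℝ, Y)) (I' := 𝓘(ℝ, X)) (I'' := 𝓘(ℝ, V)) q hg
    hh.mdifferentiableAt
  rw [mfderiv_eq_fderiv] at hcomp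
  exact α.apply_congr rfl (funext fun i => DFunLike.congr_fun hcomp (v i))

end DForm

section

variable [IsManifold 𝓘(ℝ, V) ∞ N]

theorem contMDiffAt_chartAt (hy : y ∈ (chartAt V y₀).source) :
    ContMDiffAt 𝓘(ℝ, V) 𝓘(ℝ, V) ∞ (chartAt V y₀) y :=
  contMDiffAt_of_mem_maximalAtlas (IsManifold.chart_mem_maximalAtlas y₀) hy

theorem contMDiffAt_chartAt_symm (hz : z ∈ (chartAt V y₀).target) :
    ContMDiffAt 𝓘(ℝ, V) 𝓘(ℝ, V) ∞ (chartAt V y₀).symm z :=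
  contMDiffAt_symm_of_mem_maximalAtlas (IsManifold.chart_mem_maximalAtlas y₀) hz

theorem contDiffAt_chartAt_comp (hg : ContMDiffAt 𝓘(ℝ, X) 𝓘(ℝ, V) ∞ g p)
    (hp : g p ∈ (chartAt V y₀).source) : ContDiffAt ℝ ∞ (chartAt V y₀ ∘ g) p :=
  contMDiffAt_iff_contDiffAt.1 ((contMDiffAt_chartAt hp).comp p hg)

theorem hasMFDerivAt_chartAt (hy : y ∈ (chartAt V y₀).source) :
    HasMFDerivAt 𝓘(ℝ, V) 𝓘(ℝ, V) (chartAt V y₀) y (dChart V y₀ y) :=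
  ((contMDiffAt_chartAt hy).mdifferentiableAt (by simp)).hasMFDerivAt

theorem hasMFDerivAt_chartAt_symm (hy : y ∈ (chartAt V y₀).source) :
    HasMFDerivAt 𝓘(ℝ, V) 𝓘(ℝ, V) (chartAt V y₀).symm (chartAt V y₀ y) (dChartSymm V y₀ y) :=
  ((contMDiffAt_chartAt_symm ((chartAt V y₀).map_source hy)).mdifferentiableAt
    (by simp)).hasMFDerivAt

theorem dChartSymm_comp_dChart (hy : y ∈ (chartAt V y₀).source) :
    (dChartSymm V y₀ y).comp (dChart V y₀ y) = .id ℝ V :=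
  (mdifferentiable_chart y₀).symm_comp_deriv hy

theorem dChart_comp_dChartSymm (hy : y ∈ (chartAt V y₀).source) :
    (dChart V y₀ y).comp (dChartSymm V y₀ y) = .id ℝ V := by
  have hcomp : (dChart V y₀ ((chartAt V y₀).symm (chartAt V y₀ y))).comp (dChartSymm V y₀ y) =
      .id ℝ V :=
    (mdifferentiable_chart y₀).comp_symm_deriv ((chartAt V y₀).map_source hy)
  rwa [(chartAt V y₀).left_inv hy] at hcomp

theorem mfderiv_dChartSymm {f : N → ℝ} (hf : MDifferentiableAt 𝓘(ℝ, V) 𝓘(ℝ, ℝ) f y)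
    (hy : y ∈ (chartAt V y₀).source) (v : V) :
    mfderiv 𝓘(ℝ, V) 𝓘(ℝ, ℝ) f y (dChartSymm V y₀ y v) =
      fderiv ℝ (f ∘ (chartAt V y₀).symm) (chartAt V y₀ y) v := by
  have hfy := hf.hasMFDerivAt
  have hsymm := hasMFDerivAt_chartAt_symm hy
  have hback := (chartAt V y₀).left_inv hy
  rw [← mfderiv_eq_fderiv]
  rw [← hback] at hf
  refine Eq.trans ?_ (DFunLike.congr_fun (mfderiv_comp _ hf hsymm.mdifferentiableAt) v).symm
  rw [hback]
  rfl

end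

namespace DForm

variable {α : DForm V N k}

theorem IsSmooth.contDiffAt_inChart (hα : α.IsSmooth) (hz : z ∈ (chartAt V y₀).target) :
    ContDiffAt ℝ ∞ (α.inChart y₀) z :=
  (hα y₀).contDiffAt ((chartAt V y₀).open_target.mem_nhds hz)

theorem IsSmooth.neg (hα : α.IsSmooth) : (-α).IsSmooth := fun y₀ => (hα y₀).neg

theorem IsSmooth.sub {β : DForm V N k} (hα : α.IsSmooth) (hβ : β.IsSmooth) : (α - β).IsSmooth :=
  fun y₀ => (hα y₀).sub (hβ y₀)

theorem IsSmooth.vanishesOn_extDeriv (hα : α.IsSmooth) {K : Submodule ℝ V} {r : ℕ}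
    (h : ∀ᶠ y' in 𝓝 y, VanishesOn K r
      ((α y' : V [⋀^Fin k]→L[ℝ] ℝ).compContinuousLinearMap (dChartSymm V y y'))) :
    VanishesOn (K.comap (dChart V y y).toLinearMap) (r + 1)
      (α.extDeriv y : V [⋀^Fin (k + 1)]→L[ℝ] ℝ) := by
  refine (VanishesOn.extDeriv ((hα.contDiffAt_inChart (mem_chart_target V y)).differentiableAt
    (by simp)) ?_).compContinuousLinearMap le_rfl
  rw [← (chartAt V y).map_nhds_eq (mem_chart_source V y), Filter.eventually_map]
  filter_upwards [h, chart_source_mem_nhds V y] with y' hy' hsource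
  rwa [α.inChart_chartAt hsource]

variable [IsManifold 𝓘(ℝ, V) ∞ N]

theorem pull_eventuallyEq (α : DForm V N k) (hg : ContMDiffAt 𝓘(ℝ, X) 𝓘(ℝ, V) ∞ g p)
    (hp : g p ∈ (chartAt V y₀).source) :
    α.pull g =ᶠ[𝓝 p] fun q => (α.inChart y₀ ((chartAt V y₀ ∘ g) q)).compContinuousLinearMap
      (fderiv ℝ (chartAt V y₀ ∘ g) q) := by
  have hsource : ∀ᶠ q in 𝓝 p, g q ∈ (chartAt V y₀).source :=
    hg.continuousAt.preimage_mem_nhds ((chartAt V y₀).open_source.mem_nhds hp)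
  have hsmooth : ∀ᶠ q in 𝓝 p, ContDiffAt ℝ 1 (chartAt V y₀ ∘ g) q :=
    ((contDiffAt_chartAt_comp hg hp).of_le (by simp)).eventually (by simp)
  filter_upwards [hsource.eventually_nhds, hsmooth] with q hq hq'
  have hfactor : g =ᶠ[𝓝 q] (chartAt V y₀).symm ∘ (chartAt V y₀ ∘ g) :=
    hq.mono fun r hr => ((chartAt V y₀).left_inv hr).symm
  rw [α.pull_congr hfactor]
  exact α.pull_comp ((contMDiffAt_chartAt_symm
    ((chartAt V y₀).map_source hq.self_of_nhds)).mdifferentiableAt (by simp))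
    (hq'.differentiableAt (by simp))

theorem contDiffAt_pull [FiniteDimensional ℝ X] (hg : ContMDiffAt 𝓘(ℝ, X) 𝓘(ℝ, V) ∞ g p)
    (hp : g p ∈ (chartAt V y₀).source)
    (hα : ContDiffAt ℝ ∞ (α.inChart y₀) (chartAt V y₀ (g p))) : ContDiffAt ℝ ∞ (α.pull g) p := by
  have hchart := contDiffAt_chartAt_comp hg hp
  exact (contDiffAt_compContinuousLinearMap (f := α.inChart y₀ ∘ chartAt V y₀ ∘ g)
    (hα.comp p hchart) (hchart.fderiv_right (by simp))).congr_of_eventuallyEq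
    (α.pull_eventuallyEq hg hp)

theorem IsSmooth.contDiffAt_pull [FiniteDimensional ℝ X] (hα : α.IsSmooth)
    (hg : ContMDiffAt 𝓘(ℝ, X) 𝓘(ℝ, V) ∞ g p) : ContDiffAt ℝ ∞ (α.pull g) p :=
  DForm.contDiffAt_pull hg (mem_chart_source V (g p))
    (hα.contDiffAt_inChart (mem_chart_target V (g p)))

theorem isSmooth_of_contDiffAt [FiniteDimensional ℝ V]
    (h : ∀ y, ContDiffAt ℝ ∞ (α.inChart y) (chartAt V y y)) : α.IsSmooth := fun y z hz =>
  (contDiffAt_pull (contMDiffAt_chartAt_symm hz) (mem_chart_source V _)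
    (h ((chartAt V y).symm z))).contDiffWithinAt

theorem isSmooth_of_eventually_eq [FiniteDimensional ℝ V] (f : N → V → V [⋀^Fin k]→L[ℝ] ℝ)
    (hf : ∀ y, ContDiffAt ℝ ∞ (f y) (chartAt V y y))
    (h : ∀ y, ∀ᶠ y' in 𝓝 y, (α y' : V [⋀^Fin k]→L[ℝ] ℝ).compContinuousLinearMap
      (dChartSymm V y y') = f y (chartAt V y y')) : α.IsSmooth :=
  isSmooth_of_contDiffAt fun y => (hf y).congr_of_eventuallyEq <| by
    rw [Filter.EventuallyEq, ← (chartAt V y).map_nhds_eq (mem_chart_source V y),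
      Filter.eventually_map]
    filter_upwards [h y, chart_source_mem_nhds V y] with y' hy' hsource
    rw [α.inChart_chartAt hsource, hy']

theorem inChart_extDeriv (hα : α.IsSmooth) (hz : z ∈ (chartAt V y₀).target) :
    α.extDeriv.inChart y₀ z = _root_.extDeriv (α.inChart y₀) z := by
  set y := (chartAt V y₀).symm z
  have hsymm := contMDiffAt_chartAt_symm hz
  have htransition := contDiffAt_chartAt_comp hsymm (mem_chart_source V y)
  have hpullback := extDeriv_pullback (f := chartAt V y ∘ (chartAt V y₀).symm) (r := ∞)
    ((hα.contDiffAt_inChart (mem_chart_target V y)).differentiableAt (by simp)) htransition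
    (by rw [minSmoothness_of_isRCLikeNormedField]; exact WithTop.coe_le_coe.2 le_top)
  refine Eq.trans ?_ (((α.pull_eventuallyEq hsymm (mem_chart_source V y)).extDeriv_eq).trans
    hpullback).symm
  have hcomp := mfderiv_comp z ((contMDiffAt_chartAt (mem_chart_source V y)).mdifferentiableAt
    (by simp)) (hsymm.mdifferentiableAt (by simp))
  rw [mfderiv_eq_fderiv] at hcomp
  ext v
  exact congrArg (_root_.extDeriv (α.inChart y) (chartAt V y y))
    (funext fun i => (DFunLike.congr_fun hcomp (v i)).symm)

theorem IsSmooth.extDeriv (hα : α.IsSmooth) : α.extDeriv.IsSmooth := fun y₀ => by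
  refine ContDiffOn.congr (f := _root_.extDeriv (α.inChart y₀)) ?_ fun z hz =>
    inChart_extDeriv hα hz
  exact (ContinuousAlternatingMap.alternatizeUncurryFinCLM ℝ V ℝ).contDiff.comp_contDiffOn
    ((hα y₀).fderiv_of_isOpen (m := ∞) (chartAt V y₀).open_target (by simp))

end DForm

end DifferentialForms

section JetCoordinates

variable {m n : ℕ} {M E : Type*} [TopologicalSpace M] [ChartedSpace (R m) M]
  [TopologicalSpace E] [ChartedSpace (R (m + n)) E] {π : FibredManifold m n M E} {j₀ j : Jet π}

/-- The fibred coordinates that induce the preferred chart of `J¹π` at `j`. -/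
def Jet.fibredChart (j : Jet π) : AdaptedChart π := (exists_adaptedChart π j.point).choose

/-- The coordinate expression `((x, y), v) ↦ x` of the projection `J¹π → M`. -/
def baseCoord (m n : ℕ) : JetModel m n →L[ℝ] R m :=
  (ContinuousLinearMap.fst ℝ (R m) (R n)).comp
    (ContinuousLinearMap.fst ℝ (R m × R n) (R m →L[ℝ] R n))

/-- The coordinate expression `dy^A - v^A_α dx^α` of the contact form. -/
def contactCoord (v : R m →L[ℝ] R n) : JetModel m n →L[ℝ] R n :=
  (ContinuousLinearMap.snd ℝ (R m) (R n)).comp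
    (ContinuousLinearMap.fst ℝ (R m × R n) (R m →L[ℝ] R n)) - v.comp (baseCoord m n)

theorem Jet.base_toBase (hj : j ∈ (chartAt (JetModel m n) j₀).source) :
    j₀.fibredChart.base j.toBase = baseCoord m n (chartAt (JetModel m n) j₀ j) :=
  (j₀.fibredChart.fst_tot _ hj).symm

theorem Jet.baseCoord_chartAt_mem_target (hj : j ∈ (chartAt (JetModel m n) j₀).source) :
    baseCoord m n (chartAt (JetModel m n) j₀ j) ∈ j₀.fibredChart.base.target := by
  rw [← base_toBase hj]
  exact j₀.fibredChart.base_mem_target hj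

theorem Jet.base_symm_baseCoord (hj : j ∈ (chartAt (JetModel m n) j₀).source) :
    j₀.fibredChart.base.symm (baseCoord m n (chartAt (JetModel m n) j₀ j)) = j.toBase := by
  rw [← base_toBase hj]
  exact j₀.fibredChart.base.left_inv (j₀.fibredChart.proj_mem _ hj)

theorem Jet.contMDiff_point :
    ContMDiff 𝓘(ℝ, JetModel m n) (𝓡 (m + n)) ∞ (Jet.point (π := π)) := fun j => by
  have hj := mem_chart_source (JetModel m n) j
  have hfst : ContMDiffAt 𝓘(ℝ, JetModel m n) 𝓘(ℝ, R m × R n) ∞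
      (Prod.fst : JetModel m n → R m × R n) (chartAt (JetModel m n) j j) :=
    contDiff_fst.contMDiff.contMDiffAt
  have htot : ContMDiffAt 𝓘(ℝ, R m × R n) (𝓡 (m + n)) ∞ j.fibredChart.tot.symm
      (chartAt (JetModel m n) j j).1 := j.fibredChart.smooth_tot_symm.contMDiffAt
    (j.fibredChart.tot.open_target.mem_nhds ((chartAt (JetModel m n) j).map_source hj))
  refine (htot.comp j (hfst.comp j (contMDiffAt_chartAt hj))).congr_of_eventuallyEq ?_
  filter_upwards [chart_source_mem_nhds (JetModel m n) j] with j' hj'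
  exact (j.fibredChart.tot.left_inv hj').symm

theorem Jet.contMDiff_toBase :
    ContMDiff 𝓘(ℝ, JetModel m n) (𝓡 m) ∞ (Jet.toBase (π := π)) :=
  π.smooth.comp Jet.contMDiff_point

/-- The differential of `J¹π → E`, read in the model spaces. -/
def Jet.dPoint (j : Jet π) : JetModel m n →L[ℝ] R (m + n) :=
  mfderiv 𝓘(ℝ, JetModel m n) (𝓡 (m + n)) (Jet.point (π := π)) j

/-- The differential of `J¹π → M`, read in the model spaces. -/
def Jet.dToBase (j : Jet π) : JetModel m n →L[ℝ] R m :=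
  mfderiv 𝓘(ℝ, JetModel m n) (𝓡 m) (Jet.toBase (π := π)) j

theorem Jet.dTot_comp_dPoint (hj : j ∈ (chartAt (JetModel m n) j₀).source) :
    (j₀.fibredChart.dTot j.point).comp j.dPoint =
      (ContinuousLinearMap.fst ℝ (R m × R n) (R m →L[ℝ] R n)).comp
        (dChart (JetModel m n) j₀ j) :=
  comp_eq_comp_of_hasMFDerivAt (f := j₀.fibredChart.tot) (g := Jet.point)
    (f' := Prod.fst) (j₀.fibredChart.mdiff_tot hj).hasMFDerivAt
    (Jet.contMDiff_point.mdifferentiableAt (by simp)).hasMFDerivAt hasFDerivAt_fst.hasMFDerivAt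
    (hasMFDerivAt_chartAt hj) (Filter.EventuallyEq.of_eq rfl)

theorem Jet.dBase_comp_dToBase (hj : j ∈ (chartAt (JetModel m n) j₀).source) :
    (j₀.fibredChart.dBase j.toBase).comp j.dToBase =
      (baseCoord m n).comp (dChart (JetModel m n) j₀ j) := by
  refine comp_eq_comp_of_hasMFDerivAt (f := j₀.fibredChart.base) (g := Jet.toBase)
    (j₀.fibredChart.mdiff_base (j₀.fibredChart.proj_mem _ hj)).hasMFDerivAt
    (Jet.contMDiff_toBase.mdifferentiableAt (by simp)).hasMFDerivAt
    (baseCoord m n).hasFDerivAt.hasMFDerivAt (hasMFDerivAt_chartAt hj) ?_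
  filter_upwards [(chartAt (JetModel m n) j₀).open_source.mem_nhds hj] with j' hj'
  exact base_toBase hj'

theorem Jet.dToBase_comp_dChartSymm (hj : j ∈ (chartAt (JetModel m n) j₀).source) :
    j.dToBase.comp (dChartSymm (JetModel m n) j₀ j) =
      (j₀.fibredChart.dBaseSymm (baseCoord m n (chartAt (JetModel m n) j₀ j))).comp
        (baseCoord m n) := by
  have hbase : (j₀.fibredChart.dBaseSymm (j₀.fibredChart.base j.toBase)).comp
      (j₀.fibredChart.dBase j.toBase) = .id ℝ (R m) :=
    j₀.fibredChart.dBaseSymm_comp_dBase (j₀.fibredChart.proj_mem _ hj)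
  rw [base_toBase hj] at hbase
  have hcomp := congrArg (fun A => (j₀.fibredChart.dBaseSymm
    (baseCoord m n (chartAt (JetModel m n) j₀ j))).comp
      (A.comp (dChartSymm (JetModel m n) j₀ j))) (dBase_comp_dToBase hj)
  simpa only [← ContinuousLinearMap.comp_assoc, hbase, ContinuousLinearMap.id_comp,
    ContinuousLinearMap.comp_assoc (baseCoord m n),
    ContinuousLinearMap.comp_assoc _ (baseCoord m n), dChart_comp_dChartSymm hj,
    ContinuousLinearMap.comp_id] using hcomp

theorem Jet.snd_dTot_contact (hj : j ∈ (chartAt (JetModel m n) j₀).source) (X : JetModel m n) :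
    (j₀.fibredChart.dTot j.point (j.contact X)).2 =
      contactCoord (j₀.fibredChart.velocity j) (dChart (JetModel m n) j₀ j X) := by
  set c := j₀.fibredChart
  set w := AdaptedChart.dProj π j.point (j.dPoint X)
  have hpoint : c.dTot j.point (j.dPoint X) = (dChart (JetModel m n) j₀ j X).1 :=
    DFunLike.congr_fun (dTot_comp_dPoint hj) X
  have hproj : (c.dTot j.point (j.dPoint X)).1 = c.dBase (π.proj j.point) w :=
    DFunLike.congr_fun (c.fst_comp_dTot hj) (j.dPoint X)
  have htangent : c.dTot j.point (j.tangent w) =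
      (c.dBase (π.proj j.point) w, c.velocity j (c.dBase (π.proj j.point) w)) :=
    DFunLike.congr_fun (c.dTot_comp_tangent j hj) w
  change (c.dTot j.point (j.dPoint X - j.tangent w)).2 = _
  rw [map_sub, Prod.snd_sub, htangent, ← hproj, hpoint]
  rfl

/-- The linear part of the velocity coordinates of `c` in the affine fibre over `e`. -/
def AdaptedChart.velocityLin (c : AdaptedChart π) (e : E) :
    (R m →L[ℝ] R (m + n)) →L[ℝ] (R m →L[ℝ] R n) :=
  (ContinuousLinearMap.compL ℝ (R m) (R (m + n)) (R n)
    ((ContinuousLinearMap.snd ℝ (R m) (R n)).comp (c.dTot e))).comp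
    ((ContinuousLinearMap.compL ℝ (R m) (R m) (R (m + n))).flip
      (c.dBaseSymm (c.base (π.proj e))))

theorem AdaptedChart.velocity_translate (c : AdaptedChart π) (j : Jet π) (u : vertHom π j.point) :
    c.velocity (j.translate u) = c.velocity j + c.velocityLin j.point u.1 :=
  (c.velocityLin j.point).map_add j.tangent u.1

theorem Jet.chartAt_translate (u : vertHom π j.point) :
    chartAt (JetModel m n) j₀ (j.translate u) = chartAt (JetModel m n) j₀ j +
      ContinuousLinearMap.inr ℝ (R m × R n) (R m →L[ℝ] R n)
        (j₀.fibredChart.velocityLin j.point u.1) :=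
  Prod.ext (add_zero _).symm (j₀.fibredChart.velocity_translate j u)

theorem Jet.vertLift_eq (hj : j ∈ (chartAt (JetModel m n) j₀).source) (u : vertHom π j.point) :
    j.vertLift u = dChartSymm (JetModel m n) j₀ j
      (ContinuousLinearMap.inr ℝ (R m × R n) (R m →L[ℝ] R n)
        (j₀.fibredChart.velocityLin j.point u.1)) := by
  have htranslate (u : vertHom π j.point) : j.translate u = (chartAt (JetModel m n) j₀).symm
      (chartAt (JetModel m n) j₀ j + ContinuousLinearMap.inr ℝ (R m × R n) (R m →L[ℝ] R n)
        (j₀.fibredChart.velocityLin j.point u.1)) := by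
    have hu : j.translate u ∈ (chartAt (JetModel m n) j₀).source := hj
    rw [← chartAt_translate, (chartAt (JetModel m n) j₀).left_inv hu]
  exact dMap_eq_of_eq_comp_add ((ContinuousLinearMap.inr ℝ (R m × R n) (R m →L[ℝ] R n)).comp
    (j₀.fibredChart.velocityLin j.point)) htranslate (hasMFDerivAt_chartAt_symm hj) u

theorem Jet.verticalEndo_apply (hj : j ∈ (chartAt (JetModel m n) j₀).source)
    (a : R m →L[ℝ] ℝ) (X : JetModel m n) :
    j.verticalEndo a X = dChartSymm (JetModel m n) j₀ j
      (ContinuousLinearMap.inr ℝ (R m × R n) (R m →L[ℝ] R n)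
        ((a.comp (j₀.fibredChart.dBaseSymm (baseCoord m n (chartAt (JetModel m n) j₀ j)))).smulRight
          (contactCoord (j₀.fibredChart.velocity j) (dChart (JetModel m n) j₀ j X)))) := by
  refine (vertLift_eq hj _).trans (congrArg _ (congrArg _ (ContinuousLinearMap.ext fun w => ?_)))
  rw [← snd_dTot_contact hj, ← base_toBase hj]
  exact congrArg Prod.snd ((j₀.fibredChart.dTot j.point).map_smul _ (j.contact X))

end JetCoordinates

section MomentumMap

variable {m n : ℕ} {M E : Type*} [TopologicalSpace M] [ChartedSpace (R m) M]
  [TopologicalSpace E] [ChartedSpace (R (m + n)) E] {π : FibredManifold m n M E}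
  {j₀ j : Jet π} {L : Jet π → ℝ} {η : DForm (R m) M m}

theorem apply_sum_smul_single (G : (R m →L[ℝ] ℝ) →L[ℝ] ℝ) (a : R m →L[ℝ] ℝ) :
    a (∑ ν, G (EuclideanSpace.proj ν) • EuclideanSpace.single ν 1) = G a := by
  have ha : a = ∑ ν, a (EuclideanSpace.single ν 1) • (EuclideanSpace.proj ν : R m →L[ℝ] ℝ) := by
    ext x
    conv_lhs => rw [← (EuclideanSpace.basisFun (Fin m) ℝ).sum_repr x]
    simp [map_sum, _root_.sum_apply, mul_comm]
  conv_rhs => rw [ha]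
  simp [map_sum, mul_comm]

theorem sum_proj_comp_smul_single (G : (R m →L[ℝ] ℝ) →L[ℝ] ℝ) (B : R m →L[ℝ] R m) :
    ∑ μ, G ((EuclideanSpace.proj μ).comp B) • EuclideanSpace.single μ 1 =
      B (∑ ν, G (EuclideanSpace.proj ν) • EuclideanSpace.single ν 1) := by
  ext μ
  refine Eq.trans ?_ (apply_sum_smul_single G ((EuclideanSpace.proj μ).comp B)).symm
  simp [Finset.sum_apply, Pi.single_apply]

/-- The coordinate expression `∂L/∂v^A_ν (dy^A - v^A_α dx^α) ⊗ ∂/∂x^ν` of the momentum map, where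
`D` is the differential of `L` in coordinates. -/
def momentumCoord (D : JetModel m n →L[ℝ] ℝ) (v : R m →L[ℝ] R n) : JetModel m n →L[ℝ] R m :=
  ∑ ν : Fin m, (D.comp ((ContinuousLinearMap.inr ℝ (R m × R n) (R m →L[ℝ] R n)).comp
    ((ContinuousLinearMap.smulRightL ℝ (R m) (R n) (EuclideanSpace.proj ν)).comp
      (contactCoord v)))).smulRight (EuclideanSpace.single ν 1 : R m)

theorem momentumCoord_apply (D : JetModel m n →L[ℝ] ℝ) (v : R m →L[ℝ] R n) (X : JetModel m n) :
    momentumCoord D v X = ∑ ν : Fin m,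
      D (0, (EuclideanSpace.proj ν : R m →L[ℝ] ℝ).smulRight (contactCoord v X)) •
        EuclideanSpace.single ν 1 :=
  _root_.sum_apply _ _ _

theorem contDiffAt_momentumCoord {X : Type*} [NormedAddCommGroup X] [NormedSpace ℝ X] {x : X}
    {k : WithTop ℕ∞} {D : X → JetModel m n →L[ℝ] ℝ} {v : X → R m →L[ℝ] R n}
    (hD : ContDiffAt ℝ k D x) (hv : ContDiffAt ℝ k v x) :
    ContDiffAt ℝ k (fun z => momentumCoord (D z) (v z)) x := by
  refine ContDiffAt.sum fun ν _ => ContDiffAt.smulRight ?_ contDiffAt_const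
  exact hD.clm_comp (contDiffAt_const.clm_comp (contDiffAt_const.clm_comp
    (contDiffAt_const.sub (hv.clm_comp contDiffAt_const))))

theorem momentumMap_eq (hL : MDifferentiableAt 𝓘(ℝ, JetModel m n) 𝓘(ℝ, ℝ) L j)
    (hj : j ∈ (chartAt (JetModel m n) j₀).source) :
    momentumMap L j =
      (j₀.fibredChart.dBaseSymm (baseCoord m n (chartAt (JetModel m n) j₀ j))).comp
        ((momentumCoord (fderiv ℝ (L ∘ (chartAt (JetModel m n) j₀).symm)
          (chartAt (JetModel m n) j₀ j)) (j₀.fibredChart.velocity j)).comp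
            (dChart (JetModel m n) j₀ j)) := by
  ext1 X
  let χ := chartAt (JetModel m n) j₀
  let dL : JetModel m n →L[ℝ] ℝ := mfderiv 𝓘(ℝ, JetModel m n) 𝓘(ℝ, ℝ) L j
  let B : R m →L[ℝ] R m := j₀.fibredChart.dBaseSymm (baseCoord m n (χ j))
  let G : (R m →L[ℝ] ℝ) →L[ℝ] ℝ := (fderiv ℝ (L ∘ χ.symm) (χ j)).comp
    ((ContinuousLinearMap.inr ℝ (R m × R n) (R m →L[ℝ] R n)).comp
      ((ContinuousLinearMap.smulRightL ℝ (R m) (R n)).flip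
        (contactCoord (j₀.fibredChart.velocity j) (dChart (JetModel m n) j₀ j X))))
  have hterm (μ : Fin m) : dL (j.verticalEndo (EuclideanSpace.proj μ) X) =
      G ((EuclideanSpace.proj μ).comp B) :=
    (congrArg dL (Jet.verticalEndo_apply hj _ X)).trans (mfderiv_dChartSymm hL hj _)
  have hsum : momentumMap L j X = ∑ μ : Fin m,
      dL (j.verticalEndo (EuclideanSpace.proj μ) X) • (EuclideanSpace.single μ 1 : R m) :=
    _root_.sum_apply _ _ _
  simp only [hterm] at hsum
  refine hsum.trans ((sum_proj_comp_smul_single G B).trans ?_)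
  exact congrArg B (momentumCoord_apply _ _ _).symm

end MomentumMap

section PoincareCartanAlgebra

variable {T T' U U' : Type*} [AddCommGroup T] [Module ℝ T] [TopologicalSpace T]
  [AddCommGroup T'] [Module ℝ T'] [TopologicalSpace T'] [AddCommGroup U] [Module ℝ U]
  [TopologicalSpace U] [AddCommGroup U'] [Module ℝ U'] [TopologicalSpace U'] {k : ℕ}

/-- The alternating map on `T` obtained from an alternating map `f` on `U` as `Θ_ℒ = i(𝒱)ℒ + ℒ` is
obtained from `η`: `A` stands for the momentum map, `B` for the projection and `c` for `L`. -/
def poincareCartanAlt (f : U [⋀^Fin k]→L[ℝ] ℝ) (A B : T →L[ℝ] U) (c : ℝ) : T [⋀^Fin k]→L[ℝ] ℝ :=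
  mixedPart 1 f A B + c • f.compContinuousLinearMap B

theorem poincareCartanAlt_compContinuousLinearMap (f : U [⋀^Fin k]→L[ℝ] ℝ) {A B : T →L[ℝ] U}
    {A' B' : T' →L[ℝ] U'} {D : T' →L[ℝ] T} {D' : U' →L[ℝ] U} (hA : A.comp D = D'.comp A')
    (hB : B.comp D = D'.comp B') (c : ℝ) :
    (poincareCartanAlt f A B c).compContinuousLinearMap D =
      poincareCartanAlt (f.compContinuousLinearMap D') A' B' c := by
  have hcomp : (f.compContinuousLinearMap B).compContinuousLinearMap D =
      (f.compContinuousLinearMap D').compContinuousLinearMap B' :=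
    ContinuousAlternatingMap.ext fun v =>
      congrArg f (funext fun i => DFunLike.congr_fun hB (v i))
  exact congrArg₂ (· + ·) (mixedPart_compContinuousLinearMap 1 f hA hB) (congrArg (c • ·) hcomp)

theorem vanishesOn_ker_poincareCartanAlt (f : U [⋀^Fin k]→L[ℝ] ℝ) (A B : T →L[ℝ] U) (c : ℝ) :
    VanishesOn B.ker 2 (poincareCartanAlt f A B c) :=
  (vanishesOn_ker_mixedPart 1 f A B).add
    (((vanishesOn_ker_compContinuousLinearMap f B).mono one_le_two).smul c)

theorem contDiffAt_poincareCartanAlt {X V W : Type*} [NormedAddCommGroup X] [NormedSpace ℝ X]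
    [NormedAddCommGroup V] [NormedSpace ℝ V] [NormedAddCommGroup W] [NormedSpace ℝ W]
    [FiniteDimensional ℝ V] {x : X} {n : WithTop ℕ∞}
    {f : X → W [⋀^Fin k]→L[ℝ] ℝ} {A B : X → V →L[ℝ] W} {c : X → ℝ} (hf : ContDiffAt ℝ n f x)
    (hA : ContDiffAt ℝ n A x) (hB : ContDiffAt ℝ n B x) (hc : ContDiffAt ℝ n c x) :
    ContDiffAt ℝ n (fun z => poincareCartanAlt (f z) (A z) (B z) (c z)) x :=
  (contDiffAt_mixedPart hf hA hB).add (hc.smul (contDiffAt_compContinuousLinearMap hf hB))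

end PoincareCartanAlgebra

section PoincareCartanForms

variable {m n : ℕ} {M E : Type*} [TopologicalSpace M] [ChartedSpace (R m) M]
  [TopologicalSpace E] [ChartedSpace (R (m + n)) E] {π : FibredManifold m n M E}
  {j₀ j : Jet π} {L : Jet π → ℝ} {η : DForm (R m) M m}

/-- The coordinate expression `∂L/∂v^A_ν (dy^A - v^A_α dx^α) ∧ i(∂/∂x^ν) ω + L ω` of the
Poincaré–Cartan form in the chart at `j₀`. -/
def thetaCoord (η : DForm (R m) M m) (L : Jet π → ℝ) (j₀ : Jet π) (z : JetModel m n) :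
    JetModel m n [⋀^Fin m]→L[ℝ] ℝ :=
  poincareCartanAlt (η.pull j₀.fibredChart.base.symm (baseCoord m n z))
    (momentumCoord (fderiv ℝ (L ∘ (chartAt (JetModel m n) j₀).symm) z) z.2) (baseCoord m n)
    (L ((chartAt (JetModel m n) j₀).symm z))

theorem Jet.pull_base_symm_baseCoord (hj : j ∈ (chartAt (JetModel m n) j₀).source) :
    η.pull j₀.fibredChart.base.symm (baseCoord m n (chartAt (JetModel m n) j₀ j)) =
      (η j.toBase : R m [⋀^Fin m]→L[ℝ] ℝ).compContinuousLinearMap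
        (j₀.fibredChart.dBaseSymm (baseCoord m n (chartAt (JetModel m n) j₀ j))) :=
  ContinuousAlternatingMap.ext fun _ => η.apply_congr (base_symm_baseCoord hj) rfl

theorem poincareCartanTheta_comp_dChartSymm
    (hL : MDifferentiableAt 𝓘(ℝ, JetModel m n) 𝓘(ℝ, ℝ) L j)
    (hj : j ∈ (chartAt (JetModel m n) j₀).source) :
    (poincareCartanTheta η L j : JetModel m n [⋀^Fin m]→L[ℝ] ℝ).compContinuousLinearMap
      (dChartSymm (JetModel m n) j₀ j) = thetaCoord η L j₀ (chartAt (JetModel m n) j₀ j) := by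
  have hmomentum : (momentumMap L j : JetModel m n →L[ℝ] R m).comp
      (dChartSymm (JetModel m n) j₀ j) =
        (j₀.fibredChart.dBaseSymm (baseCoord m n (chartAt (JetModel m n) j₀ j))).comp
          (momentumCoord (fderiv ℝ (L ∘ (chartAt (JetModel m n) j₀).symm)
            (chartAt (JetModel m n) j₀ j)) (j₀.fibredChart.velocity j)) := by
    refine ContinuousLinearMap.ext fun X => ?_
    exact (DFunLike.congr_fun (momentumMap_eq hL hj) _).trans
      (congrArg (fun Y => j₀.fibredChart.dBaseSymm _ (momentumCoord _ _ Y))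
        (DFunLike.congr_fun (dChart_comp_dChartSymm hj) X))
  rw [thetaCoord, Jet.pull_base_symm_baseCoord hj, (chartAt (JetModel m n) j₀).left_inv hj]
  exact poincareCartanAlt_compContinuousLinearMap (η j.toBase : R m [⋀^Fin m]→L[ℝ] ℝ)
    (B := j.dToBase) hmomentum (Jet.dToBase_comp_dChartSymm hj) (L j)

theorem contDiffAt_thetaCoord [IsManifold (𝓡 m) ∞ M] (hη : η.IsSmooth)
    (hL : ContMDiff 𝓘(ℝ, JetModel m n) 𝓘(ℝ, ℝ) ∞ L)
    (hj : j ∈ (chartAt (JetModel m n) j₀).source) :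
    ContDiffAt ℝ ∞ (thetaCoord η L j₀) (chartAt (JetModel m n) j₀ j) := by
  have hbase : ContMDiffAt 𝓘(ℝ, R m) (𝓡 m) ∞ j₀.fibredChart.base.symm
      (baseCoord m n (chartAt (JetModel m n) j₀ j)) :=
    j₀.fibredChart.smooth_base_symm.contMDiffAt
      (j₀.fibredChart.base.open_target.mem_nhds (Jet.baseCoord_chartAt_mem_target hj))
  have hpull : ContDiffAt ℝ ∞
      (fun z => η.pull j₀.fibredChart.base.symm (baseCoord m n z))
      (chartAt (JetModel m n) j₀ j) :=
    (hη.contDiffAt_pull hbase).comp _ (baseCoord m n).contDiff.contDiffAt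
  have hcoord : ContDiffAt ℝ ∞ (L ∘ (chartAt (JetModel m n) j₀).symm)
      (chartAt (JetModel m n) j₀ j) :=
    contMDiffAt_iff_contDiffAt.1 (hL.contMDiffAt.comp _
      (contMDiffAt_chartAt_symm ((chartAt (JetModel m n) j₀).map_source hj)))
  have hmomentum : ContDiffAt ℝ ∞ (fun z : JetModel m n =>
      momentumCoord (fderiv ℝ (L ∘ (chartAt (JetModel m n) j₀).symm) z) z.2)
      (chartAt (JetModel m n) j₀ j) :=
    contDiffAt_momentumCoord (hcoord.fderiv_right (by simp)) contDiffAt_snd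
  exact contDiffAt_poincareCartanAlt hpull hmomentum contDiffAt_const hcoord

theorem isSmooth_poincareCartanTheta [IsManifold (𝓡 m) ∞ M] (hη : η.IsSmooth)
    (hL : ContMDiff 𝓘(ℝ, JetModel m n) 𝓘(ℝ, ℝ) ∞ L) : (poincareCartanTheta η L).IsSmooth :=
  DForm.isSmooth_of_eventually_eq (thetaCoord η L)
    (fun j => contDiffAt_thetaCoord hη hL (mem_chart_source _ j)) fun j => by
      filter_upwards [chart_source_mem_nhds (JetModel m n) j] with j' hj'
      exact poincareCartanTheta_comp_dChartSymm (hL.mdifferentiableAt (by simp)) hj'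

theorem isSmooth_poincareCartanOmega [IsManifold (𝓡 m) ∞ M] (hη : η.IsSmooth)
    (hL : ContMDiff 𝓘(ℝ, JetModel m n) 𝓘(ℝ, ℝ) ∞ L) : (poincareCartanOmega η L).IsSmooth :=
  (isSmooth_poincareCartanTheta hη hL).extDeriv.neg

theorem vanishesOn_poincareCartanTheta (j : Jet π) :
    VanishesOn j.dToBase.ker 2 (poincareCartanTheta η L j) :=
  vanishesOn_ker_poincareCartanAlt (η j.toBase : R m [⋀^Fin m]→L[ℝ] ℝ) (momentumMap L j)
    j.dToBase (L j)

theorem Jet.ker_baseCoord_le (hj : j ∈ (chartAt (JetModel m n) j₀).source) :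
    (baseCoord m n).ker ≤
      j.dToBase.ker.comap (dChartSymm (JetModel m n) j₀ j).toLinearMap := fun v hv => by
  have hcomp := DFunLike.congr_fun (dToBase_comp_dChartSymm hj) v
  exact hcomp.trans ((congrArg (j₀.fibredChart.dBaseSymm _) hv).trans (map_zero _))

theorem Jet.ker_dToBase_le (j : Jet π) :
    j.dToBase.ker ≤ (baseCoord m n).ker.comap (dChart (JetModel m n) j j).toLinearMap :=
  fun v hv => by
    have hcomp := DFunLike.congr_fun (dBase_comp_dToBase (mem_chart_source (JetModel m n) j)) v
    exact hcomp.symm.trans ((congrArg (j.fibredChart.dBase _) hv).trans (map_zero _))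

theorem vanishesOn_poincareCartanOmega [IsManifold (𝓡 m) ∞ M] (hη : η.IsSmooth)
    (hL : ContMDiff 𝓘(ℝ, JetModel m n) 𝓘(ℝ, ℝ) ∞ L) (j : Jet π) :
    VanishesOn j.dToBase.ker 3 (poincareCartanOmega η L j) := by
  have hd : VanishesOn ((baseCoord m n).ker.comap (dChart (JetModel m n) j j).toLinearMap) 3
      ((poincareCartanTheta η L).extDeriv j) := by
    refine (isSmooth_poincareCartanTheta hη hL).vanishesOn_extDeriv ?_
    filter_upwards [chart_source_mem_nhds (JetModel m n) j] with j' hj'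
    exact (vanishesOn_poincareCartanTheta j').compContinuousLinearMap (Jet.ker_baseCoord_le hj')
  exact fun S v hS hv => hd.neg S v hS fun i hi => j.ker_dToBase_le (hv i hi)

end PoincareCartanForms

section EhresmannConnections

variable {V W : Type*} [NormedAddCommGroup V] [NormedSpace ℝ V] [NormedAddCommGroup W]
  [NormedSpace ℝ W] {N Q : Type*} [TopologicalSpace N] [ChartedSpace V N] [TopologicalSpace Q]
  [ChartedSpace W Q] [IsManifold 𝓘(ℝ, V) ∞ N] [IsManifold 𝓘(ℝ, W) ∞ Q] {κ : N → Q} {k : ℕ}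
  {y₀ y : N}

theorem contDiffAt_chartAt_comp_comp_symm (hκ : ContMDiff 𝓘(ℝ, V) 𝓘(ℝ, W) ∞ κ)
    (hy : y ∈ (chartAt V y₀).source) (hκy : κ y ∈ (chartAt W (κ y₀)).source) :
    ContDiffAt ℝ ∞ (chartAt W (κ y₀) ∘ κ ∘ (chartAt V y₀).symm) (chartAt V y₀ y) :=
  contDiffAt_chartAt_comp
    (hκ.contMDiffAt.comp _ (contMDiffAt_chartAt_symm ((chartAt V y₀).map_source hy)))
    (by rwa [Function.comp_apply, (chartAt V y₀).left_inv hy])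

theorem DForm.IsSmooth.contDiffAt_inChart_comp {η : DForm W Q k} (hη : η.IsSmooth)
    (hκ : ContMDiff 𝓘(ℝ, V) 𝓘(ℝ, W) ∞ κ) (y₀ : N) :
    ContDiffAt ℝ ∞ (fun z => η.inChart (κ y₀)
      ((chartAt W (κ y₀) ∘ κ ∘ (chartAt V y₀).symm) z)) (chartAt V y₀ y₀) := by
  refine ContDiffAt.comp (g := η.inChart (κ y₀)) _ ?_
    (contDiffAt_chartAt_comp_comp_symm hκ (mem_chart_source V y₀) (mem_chart_source W (κ y₀)))
  rw [Function.comp_apply, Function.comp_apply, (chartAt V y₀).left_inv (mem_chart_source V y₀)]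
  exact hη.contDiffAt_inChart (mem_chart_target W (κ y₀))

theorem DForm.inChart_basis_ne_zero (b : Module.Basis (Fin k) ℝ V) {η : DForm V N k}
    (hη : η y ≠ 0) (hy : y ∈ (chartAt V y₀).source) :
    η.inChart y₀ (chartAt V y₀ y) b ≠ 0 := fun h => hη <| by
  have hzero : η.inChart y₀ (chartAt V y₀ y) = 0 :=
    ContinuousAlternatingMap.toAlternatingMap_injective
      ((AlternatingMap.map_basis_eq_zero_iff b _).1 h)
  rw [η.inChart_chartAt hy] at hzero
  refine ContinuousAlternatingMap.ext fun v => ?_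
  have hv : dChartSymm V y₀ y ∘ dChart V y₀ y ∘ v = v :=
    funext fun i => DFunLike.congr_fun (dChartSymm_comp_dChart hy) (v i)
  exact (congrArg (η y) hv).symm.trans (DFunLike.congr_fun hzero (dChart V y₀ y ∘ v))

namespace EhresmannConnection

variable (C : EhresmannConnection (V := V) (W := W) κ)

/-- The horizontal lift at `y`, read in the model spaces. -/
def liftMap (y : N) : W →L[ℝ] V := C.lift y

/-- The horizontal lift, read in the preferred charts at `y₀` and `κ y₀`. -/
def coordLift (y₀ : N) (z : V) : W →L[ℝ] V :=
  inTangentCoordinates 𝓘(ℝ, W) 𝓘(ℝ, V) κ id C.lift y₀ ((chartAt V y₀).symm z)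

/-- The horizontal projection, read in the preferred chart at `y₀`. -/
def coordHor (y₀ : N) (z : V) : V →L[ℝ] V :=
  (C.coordLift y₀ z).comp (fderiv ℝ (chartAt W (κ y₀) ∘ κ ∘ (chartAt V y₀).symm) z)

theorem contDiffAt_coordLift (y₀ : N) : ContDiffAt ℝ ∞ (C.coordLift y₀) (chartAt V y₀ y₀) :=
  contMDiffAt_iff_contDiffAt.1 (ContMDiffAt.comp_of_eq (C.smooth y₀)
    (contMDiffAt_chartAt_symm (mem_chart_target V y₀))
    ((chartAt V y₀).left_inv (mem_chart_source V y₀)))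

theorem coordLift_chartAt (hy : y ∈ (chartAt V y₀).source)
    (hκy : κ y ∈ (chartAt W (κ y₀)).source) :
    C.coordLift y₀ (chartAt V y₀ y) =
      (dChart V y₀ y).comp ((C.liftMap y).comp (dChartSymm W (κ y₀) (κ y))) := by
  rw [coordLift, (chartAt V y₀).left_inv hy]
  refine (inTangentCoordinates_eq_mfderiv_comp (I := 𝓘(ℝ, W)) (I' := 𝓘(ℝ, V)) (f := κ) (g := id)
    (ϕ := C.lift) hκy hy).trans ?_
  simp only [mfld_simps, mfderivWithin_univ]
  rfl

theorem dChartSymm_comp_coordLift (hy : y ∈ (chartAt V y₀).source)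
    (hκy : κ y ∈ (chartAt W (κ y₀)).source) :
    (dChartSymm V y₀ y).comp (C.coordLift y₀ (chartAt V y₀ y)) =
      (C.liftMap y).comp (dChartSymm W (κ y₀) (κ y)) := by
  rw [C.coordLift_chartAt hy hκy, ← ContinuousLinearMap.comp_assoc, dChartSymm_comp_dChart hy,
    ContinuousLinearMap.id_comp]

theorem contDiffAt_inChart_snoc_coordLift {m : ℕ} {α : DForm V N (m + 1)} (hα : α.IsSmooth)
    (w : Fin m → W) (X : V) (y₀ : N) :
    ContDiffAt ℝ ∞ (fun z => α.inChart y₀ z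
      (Fin.snoc (α := fun _ => V) (C.coordLift y₀ z ∘ w) X)) (chartAt V y₀ y₀) := by
  refine contDiffAt_alternatingMap_apply (hα.contDiffAt_inChart (mem_chart_target V y₀))
    fun i => ?_
  refine Fin.lastCases ?_ (fun μ => ?_) i
  · simpa only [Fin.snoc_last] using contDiffAt_const
  · simpa only [Fin.snoc_castSucc, Function.comp_apply] using
      (C.contDiffAt_coordLift y₀).clm_apply contDiffAt_const

theorem contDiffAt_coordHor (hκ : ContMDiff 𝓘(ℝ, V) 𝓘(ℝ, W) ∞ κ) (y₀ : N) :
    ContDiffAt ℝ ∞ (C.coordHor y₀) (chartAt V y₀ y₀) :=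
  (C.contDiffAt_coordLift y₀).clm_comp ((contDiffAt_chartAt_comp_comp_symm hκ
    (mem_chart_source V y₀) (mem_chart_source W (κ y₀))).fderiv_right (m := ∞) (by simp))

theorem dChartSymm_comp_coordHor (hκ : ContMDiff 𝓘(ℝ, V) 𝓘(ℝ, W) ∞ κ)
    (hy : y ∈ (chartAt V y₀).source) (hκy : κ y ∈ (chartAt W (κ y₀)).source) :
    (dChartSymm V y₀ y).comp (C.coordHor y₀ (chartAt V y₀ y)) =
      (C.horProj y : V →L[ℝ] V).comp (dChartSymm V y₀ y) := by
  let dκ : V →L[ℝ] W := mfderiv 𝓘(ℝ, V) 𝓘(ℝ, W) κ y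
  have hcoord : (fderiv ℝ (chartAt W (κ y₀) ∘ κ ∘ (chartAt V y₀).symm) (chartAt V y₀ y)).comp
      (dChart V y₀ y) = (dChart W (κ y₀) (κ y)).comp dκ :=
    comp_eq_comp_of_hasMFDerivAt (((contDiffAt_chartAt_comp_comp_symm hκ hy
      hκy).differentiableAt (by simp)).hasFDerivAt.hasMFDerivAt) (hasMFDerivAt_chartAt hy)
      (hasMFDerivAt_chartAt hκy) (hκ.contMDiffAt.mdifferentiableAt (by simp)).hasMFDerivAt <| by
        filter_upwards [(chartAt V y₀).open_source.mem_nhds hy] with y' hy'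
        simp only [Function.comp_apply, (chartAt V y₀).left_inv hy']
  have hconj : ((dChartSymm V y₀ y).comp (C.coordHor y₀ (chartAt V y₀ y))).comp (dChart V y₀ y) =
      (C.liftMap y).comp dκ := by
    rw [coordHor, ← ContinuousLinearMap.comp_assoc, C.dChartSymm_comp_coordLift hy hκy,
      ContinuousLinearMap.comp_assoc, hcoord, ContinuousLinearMap.comp_assoc,
      ← ContinuousLinearMap.comp_assoc _ _ dκ, dChartSymm_comp_dChart hκy,
      ContinuousLinearMap.id_comp]
  refine Eq.trans ?_ (congrArg (fun A : V →L[ℝ] V => A.comp (dChartSymm V y₀ y)) hconj)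
  rw [ContinuousLinearMap.comp_assoc, dChart_comp_dChartSymm hy, ContinuousLinearMap.comp_id]

variable {C}

theorem isSmooth_bidegreePart [FiniteDimensional ℝ V] (hκ : ContMDiff 𝓘(ℝ, V) 𝓘(ℝ, W) ∞ κ)
    {α : DForm V N k} (hα : α.IsSmooth) (p : ℕ) : (C.bidegreePart p α).IsSmooth := by
  refine DForm.isSmooth_of_eventually_eq (fun y₀ z => mixedPart p (α.inChart y₀ z)
    (C.coordHor y₀ z) (.id ℝ V - C.coordHor y₀ z)) (fun y₀ => ?_) fun y₀ => ?_
  · exact contDiffAt_mixedPart (hα.contDiffAt_inChart (mem_chart_target V y₀))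
      (C.contDiffAt_coordHor hκ y₀) (contDiffAt_const.sub (C.contDiffAt_coordHor hκ y₀))
  · filter_upwards [chart_source_mem_nhds V y₀,
      hκ.continuous.continuousAt.preimage_mem_nhds (chart_source_mem_nhds W _)] with y hy hκy
    have hhor := C.dChartSymm_comp_coordHor hκ hy hκy
    have hver : (dChartSymm V y₀ y).comp (.id ℝ V - C.coordHor y₀ (chartAt V y₀ y)) =
        (C.verProj y : V →L[ℝ] V).comp (dChartSymm V y₀ y) := by
      rw [ContinuousLinearMap.comp_sub, hhor]
      rfl
    refine (mixedPart_compContinuousLinearMap p _ hhor.symm hver.symm).trans ?_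
    rw [α.inChart_chartAt hy]

theorem isSmooth_remainder [FiniteDimensional ℝ V] {m : ℕ} (hκ : ContMDiff 𝓘(ℝ, V) 𝓘(ℝ, W) ∞ κ)
    {α : DForm V N (m + 1)} (hα : α.IsSmooth) : (C.remainder α).IsSmooth :=
  hα.sub (isSmooth_bidegreePart hκ hα m)

theorem bidegreePart_bidegreePart (p : ℕ) (α : DForm V N k) :
    C.bidegreePart p (C.bidegreePart p α) = C.bidegreePart p α :=
  funext fun y => mixedPart_mixedPart_self_of_comp_eq_id p (α y) (C.mfderiv_comp_lift y)

theorem remainder_eq_bidegreePart [FiniteDimensional ℝ W] {m : ℕ} (hW : Module.finrank ℝ W = m)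
    (hm : 1 ≤ m) {α : DForm V N (m + 1)}
    (hα : ∀ y, VanishesOn (mfderiv 𝓘(ℝ, V) 𝓘(ℝ, W) κ y).ker 3 (α y)) :
    C.remainder α = C.bidegreePart (m - 1) α :=
  funext fun y => sub_mixedPart_eq_mixedPart hW hm (C.mfderiv_comp_lift y) (hα y)

theorem hasBidegree_remainder [FiniteDimensional ℝ W] {m : ℕ} (hW : Module.finrank ℝ W = m)
    (hm : 1 ≤ m) {α : DForm V N (m + 1)}
    (hα : ∀ y, VanishesOn (mfderiv 𝓘(ℝ, V) 𝓘(ℝ, W) κ y).ker 3 (α y)) :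
    C.HasBidegree (m - 1) 2 (C.remainder α) := by
  refine ⟨by omega, ?_⟩
  rw [remainder_eq_bidegreePart hW hm hα, bidegreePart_bidegreePart]

end EhresmannConnection

end EhresmannConnections

section Decomposition

theorem exists_basis_eq_tangentBasis {m : ℕ} {M : Type*} [TopologicalSpace M]
    [ChartedSpace (R m) M] (x : M) : ∃ b : Module.Basis (Fin m) ℝ (R m), ⇑b = tangentBasis x :=
  ⟨(EuclideanSpace.basisFun (Fin m) ℝ).toBasis,
    funext fun μ => EuclideanSpace.basisFun_apply (Fin m) ℝ μ⟩

variable {V : Type*} [NormedAddCommGroup V] [NormedSpace ℝ V] [FiniteDimensional ℝ V]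
  {N : Type*} [TopologicalSpace N] [ChartedSpace V N] [IsManifold 𝓘(ℝ, V) ∞ N]
  {m : ℕ} {M : Type*} [TopologicalSpace M] [ChartedSpace (R m) M] [IsManifold (𝓡 m) ∞ M]
  {κ : N → M} {C : EhresmannConnection (V := V) (W := R m) κ}
  {η : DForm (R m) M m} {α : DForm V N (m + 1)} {y₀ y : N}

namespace EhresmannConnection

theorem mul_gammaForm_apply (hη : η (κ y) ≠ 0) (w : Fin m → R m) (u : Fin 1 → V) :
    (η (κ y) : R m [⋀^Fin m]→L[ℝ] ℝ) w * (C.gammaForm η α y : V [⋀^Fin 1]→L[ℝ] ℝ) u =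
      (α y : V [⋀^Fin (m + 1)]→L[ℝ] ℝ) (Fin.snoc (α := fun _ => V) (C.liftMap y ∘ w) (u 0)) := by
  obtain ⟨b, hb⟩ := exists_basis_eq_tangentBasis (m := m) (κ y)
  have hcontract := mul_contract_map_apply b hη (α y) (C.lift y) w u
  rw [hb] at hcontract
  exact hcontract

theorem inChart_gammaForm_apply (b : Module.Basis (Fin m) ℝ (R m)) (hη : η (κ y) ≠ 0)
    (hy : y ∈ (chartAt V y₀).source) (hκy : κ y ∈ (chartAt (R m) (κ y₀)).source)
    (u : Fin 1 → V) :
    (C.gammaForm η α).inChart y₀ (chartAt V y₀ y) u =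
      α.inChart y₀ (chartAt V y₀ y)
        (Fin.snoc (α := fun _ => V) (C.coordLift y₀ (chartAt V y₀ y) ∘ b) (u 0)) /
      η.inChart (κ y₀) (chartAt (R m) (κ y₀) (κ y)) b := by
  have hsnoc : (dChartSymm V y₀ y) ∘ Fin.snoc (α := fun _ => V)
        (C.coordLift y₀ (chartAt V y₀ y) ∘ b) (u 0) =
      Fin.snoc (α := fun _ => V) (C.liftMap y ∘ dChartSymm (R m) (κ y₀) (κ y) ∘ b)
        (dChartSymm V y₀ y (u 0)) := by
    rw [Fin.comp_snoc]
    exact congrArg (Fin.snoc (α := fun _ => V) · _)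
      (funext fun μ => DFunLike.congr_fun (C.dChartSymm_comp_coordLift hy hκy) (b μ))
  have hγ : (C.gammaForm η α).inChart y₀ (chartAt V y₀ y) u =
      (C.gammaForm η α y : V [⋀^Fin 1]→L[ℝ] ℝ) (dChartSymm V y₀ y ∘ u) :=
    DFunLike.congr_fun ((C.gammaForm η α).inChart_chartAt hy) u
  refine (eq_div_iff (DForm.inChart_basis_ne_zero b hη hκy)).2 ?_
  rw [hγ, mul_comm, η.inChart_chartAt hκy, α.inChart_chartAt hy]
  exact (mul_gammaForm_apply hη (dChartSymm (R m) (κ y₀) (κ y) ∘ b)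
    (dChartSymm V y₀ y ∘ u)).trans (congrArg (α y : V [⋀^Fin (m + 1)]→L[ℝ] ℝ) hsnoc.symm)

theorem isSmooth_gammaForm (hκ : ContMDiff 𝓘(ℝ, V) (𝓡 m) ∞ κ) (hη : IsVolumeForm η)
    (hα : α.IsSmooth) : (C.gammaForm η α).IsSmooth := by
  let b := (EuclideanSpace.basisFun (Fin m) ℝ).toBasis
  refine DForm.isSmooth_of_contDiffAt fun y₀ => contDiffAt_alternatingMap_of_apply fun u => ?_
  have hden : ContDiffAt ℝ ∞ (fun z => η.inChart (κ y₀)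
      ((chartAt (R m) (κ y₀) ∘ κ ∘ (chartAt V y₀).symm) z) b) (chartAt V y₀ y₀) :=
    contDiffAt_alternatingMap_apply (u := fun _ => b) (hη.smooth.contDiffAt_inChart_comp hκ y₀)
      fun _ => contDiffAt_const
  have hden₀ : η.inChart (κ y₀)
      ((chartAt (R m) (κ y₀) ∘ κ ∘ (chartAt V y₀).symm) (chartAt V y₀ y₀)) b ≠ 0 := by
    rw [Function.comp_apply, Function.comp_apply, (chartAt V y₀).left_inv (mem_chart_source V y₀)]
    exact DForm.inChart_basis_ne_zero b (hη.ne_zero _) (mem_chart_source (R m) (κ y₀))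
  refine ((C.contDiffAt_inChart_snoc_coordLift hα b (u 0) y₀).div hden
    hden₀).congr_of_eventuallyEq ?_
  rw [Filter.EventuallyEq, ← (chartAt V y₀).map_nhds_eq (mem_chart_source V y₀),
    Filter.eventually_map]
  filter_upwards [chart_source_mem_nhds V y₀,
    hκ.continuous.continuousAt.preimage_mem_nhds (chart_source_mem_nhds (R m) _)] with y hy hκy
  refine (inChart_gammaForm_apply b (hη.ne_zero _) hy hκy u).trans ?_
  rw [Pi.div_apply, Function.comp_apply, Function.comp_apply, (chartAt V y₀).left_inv hy]

theorem wedge_gammaForm_eq_bidegreePart (hη : η (κ y) ≠ 0) :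
    wedge (η.pullback κ y).toAlternatingMap (C.gammaForm η α y).toAlternatingMap =
      (C.bidegreePart m α y).toAlternatingMap := by
  obtain ⟨b, hb⟩ := exists_basis_eq_tangentBasis (m := m) (κ y)
  have hwedge := wedge_contract_eq_mixedPart b hη (α y) (C.lift y) (mfderiv 𝓘(ℝ, V) (𝓡 m) κ y)
  rw [hb] at hwedge
  exact hwedge

theorem eq_wedge_gammaForm_add_remainder (hη : η (κ y) ≠ 0) :
    (α y).toAlternatingMap = wedge (η.pullback κ y).toAlternatingMap
      (C.gammaForm η α y).toAlternatingMap + (C.remainder α y).toAlternatingMap := by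
  rw [wedge_gammaForm_eq_bidegreePart hη]
  exact (add_sub_cancel (C.bidegreePart m α y).toAlternatingMap _).symm

end EhresmannConnection

end Decomposition

end FieldTheory

end

theorem mainTheorem9 {m n : ℕ} (hm : 1 ≤ m) {M E : Type*}
    [TopologicalSpace M] [ChartedSpace (FieldTheory.R m) M] [IsManifold (𝓡 m) ∞ M]
    [TopologicalSpace E] [ChartedSpace (FieldTheory.R (m + n)) E] [IsManifold (𝓡 (m + n)) ∞ E]
    (π : FieldTheory.FibredManifold m n M E)
    (η : FieldTheory.DForm (FieldTheory.R m) M m) (hη : FieldTheory.IsVolumeForm η)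
    (L : FieldTheory.Jet π → ℝ)
    (hL : ContMDiff 𝓘(ℝ, FieldTheory.JetModel m n) 𝓘(ℝ, ℝ) ∞ L)
    (nabla : FieldTheory.EhresmannConnection (V := FieldTheory.JetModel m n)
      (W := FieldTheory.R m) (FieldTheory.Jet.toBase (π := π))) :
    -- `γ = i(Y)Ω_ℒ` and `Ω_ℒ^∇` are differential forms
    (nabla.gammaForm η (FieldTheory.poincareCartanOmega η L)).IsSmooth ∧
    (nabla.remainder (FieldTheory.poincareCartanOmega η L)).IsSmooth ∧
    -- `Ω_ℒ = ω ∧ γ + Ω_ℒ^∇`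
    (∀ y : FieldTheory.Jet π,
      (FieldTheory.poincareCartanOmega η L y).toAlternatingMap =
        FieldTheory.wedge (FieldTheory.omegaForm η y).toAlternatingMap
          (nabla.gammaForm η (FieldTheory.poincareCartanOmega η L) y).toAlternatingMap +
        (nabla.remainder (FieldTheory.poincareCartanOmega η L) y).toAlternatingMap) ∧
    -- `Ω_ℒ^∇` has bidegree `(m - 1, 2)`
    nabla.HasBidegree (m - 1) 2 (nabla.remainder (FieldTheory.poincareCartanOmega η L)) ∧
    -- the equivalent form of the last condition: `Ω_ℒ` vanishes on three vertical vectors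
    (∀ (y : FieldTheory.Jet π)
      (v : Fin (m + 1) → TangentSpace 𝓘(ℝ, FieldTheory.JetModel m n) y) (i j k : Fin (m + 1)),
      i ≠ j → i ≠ k → j ≠ k →
      (∀ l ∈ ({i, j, k} : Set (Fin (m + 1))),
        mfderiv 𝓘(ℝ, FieldTheory.JetModel m n) (𝓡 m) (FieldTheory.Jet.toBase (π := π)) y (v l)
          = 0) →
      FieldTheory.poincareCartanOmega η L y v = 0) := by
  have hκ : ContMDiff 𝓘(ℝ, FieldTheory.JetModel m n) (𝓡 m) ∞
      (FieldTheory.Jet.toBase (π := π)) := FieldTheory.Jet.contMDiff_toBase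
  have hΩ : (FieldTheory.poincareCartanOmega η L).IsSmooth :=
    FieldTheory.isSmooth_poincareCartanOmega hη.smooth hL
  have hvanish := FieldTheory.vanishesOn_poincareCartanOmega hη.smooth hL
  exact ⟨FieldTheory.EhresmannConnection.isSmooth_gammaForm hκ hη hΩ,
    FieldTheory.EhresmannConnection.isSmooth_remainder hκ hΩ,
    fun y => FieldTheory.EhresmannConnection.eq_wedge_gammaForm_add_remainder (hη.ne_zero _),
    FieldTheory.EhresmannConnection.hasBidegree_remainder finrank_euclideanSpace_fin hm hvanish,
    fun y v i j k hij hik hjk hv => hvanish y {i, j, k} v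
      (Finset.card_eq_three.2 ⟨i, j, k, hij, hik, hjk, rfl⟩) fun l hl => hv l (by simpa using hl)⟩
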